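/- For integers $n\ge 0$ and $0\le k,x\le n$ let $$\mathrm{kr}^{(n)}_k(x)=\binom nk^{-1}\sum_{j=0}^k(-1)^j\binom xj\binom{n-x}{k-j}$$ be the normalised Krawtchouk polynomial. Call $c\in(0,1)$ a Krawtchouk constant if $|\mathrm{kr}^{(n)}_k(x)|\le e^{-ckx/n}$ for all integers $n\ge 1$ and $0\le k,x\le n/2$. For $q\ge1$, positive integers $d,N$ and $\xi\in\mathbb T^d=(\mathbb R/\mathbb Z)^d$ put $\kappa=\kappa_q(d,N)=N/d^{1/q}$, $$B=\Big\{x\in\mathbb Z^d:\ \sum_{i=1}^d|x_i|^q\le N^q\Big\},\qquad m_N^q(\xi)=\frac1{|B|}\sum_{x\in B}e^{2\pi i\,x\cdot\xi},$$ $$\|\xi\|=\Big(\sum_{j=1}^d\sin^2(\pi\xi_j)\Big)^{1/2},\qquad \|\xi+1/2\|=\Big(\sum_{j=1}^d\cos^2(\pi\xi_j)\Big)^{1/2}.$$ **Proposition 3.5.** Krawtchouk constants exist, and there is an absolute constant $C>0$ such that for all real $q\ge1$, all positive integers $d,N$ with $\kappa_q(d,N)\le e^{-12/q}$ and all $\xi\in\mathbb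 T^d$ the following hold. 1. For every Krawtchouk constant $c$, $$|m_N^q(\xi)|\le C\Big(\exp\Big(-\frac{c\,\kappa^q}{320}\min\big(\|\xi\|^2,\|\xi+1/2\|^2\big)\Big)+\frac1{N^q}\Big).$$ 2. If $\|\xi\|\le\|\xi+1/2\|$, then $$|m_N^q(\xi)-1|\le C\Big(\kappa^q\|\xi\|^2+\frac1{N^q}+\kappa^{q/50}\Big).$$ 3. If $\|\xi\|>\|\xi+1/2\|$, then $$\Big|m_N^q(\xi)-\frac1{|B|}\sum_{x\in B}(-1)^{\sum_{i=1}^dx_i}\Big|\le C\Big(\kappa^q\|\xi+1/2\|^2+\frac1{N^q}+\kappa^{q/50}\Big).$$ -/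

import Mathlib

namespace LqBall

/-- The closed `ℓ^q` ball `B_t^q` of radius `t` centred at the origin of `ℝ^d`. -/
def ball (q : ℝ) (d : ℕ) (t : ℝ) : Set (Fin d → ℝ) :=
  {x | ∑ i, |x i| ^ q ≤ t ^ q}

/-- The lattice points of the ball, `B_t^q ∩ ℤ^d`. -/
def latticeBall (q : ℝ) (d : ℕ) (t : ℝ) : Set (Fin d → ℤ) :=
  {x | (fun i => (x i : ℝ)) ∈ ball q d t}

/-- The lattice ball is finite, so that the cardinality and the finite sums below
have their usual meaning. -/
theorem latticeBall_finite {q : ℝ} (hq : 1 ≤ q) (d : ℕ) {t : ℝ} (ht : 0 ≤ t) :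
    (latticeBall q d t).Finite := by
  have hq0 : 0 < q := by linarith
  refine (Set.Finite.pi' (fun _ : Fin d => Set.finite_Icc (-⌈t⌉) ⌈t⌉)).subset ?_
  intro x hx i
  have h1 : |(x i : ℝ)| ^ q ≤ t ^ q :=
    le_trans (Finset.single_le_sum (f := fun i => |(x i : ℝ)| ^ q)
      (fun j _ => Real.rpow_nonneg (abs_nonneg _) q) (Finset.mem_univ i)) hx
  have h2 : |(x i : ℝ)| ≤ t := (Real.rpow_le_rpow_iff (abs_nonneg _) ht hq0).1 h1
  have h3 : |(x i : ℝ)| ≤ (⌈t⌉ : ℝ) := h2.trans (Int.le_ceil t)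
  have h4 : |x i| ≤ ⌈t⌉ := by exact_mod_cast h3
  exact Set.mem_Icc.2 (abs_le.1 h4)

/-- `e(s) = exp(2πis)`. -/
noncomputable def e (s : ℝ) : ℂ :=
  Complex.exp (2 * Real.pi * Complex.I * s)

/-- The average of `f` over `B_t^q ∩ ℤ^d`. -/
noncomputable def average (q : ℝ) (d : ℕ) (t : ℝ) (f : (Fin d → ℤ) → ℂ) : ℂ :=
  (1 / ((latticeBall q d t).ncard : ℂ)) * ∑ᶠ x ∈ latticeBall q d t, f x

/-- The multiplier symbol `m_t^q(ξ)`: the average of `e(x · ξ)` over `B_t^q ∩ ℤ^d`. -/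
noncomputable def multiplier (q : ℝ) (d : ℕ) (t : ℝ) (ξ : Fin d → ℝ) : ℂ :=
  average q d t fun x => e (∑ i, (x i : ℝ) * ξ i)

/-- The average of `(-1)^{x_1 + ⋯ + x_d}` over `B_t^q ∩ ℤ^d`. -/
noncomputable def signedAverage (q : ℝ) (d : ℕ) (t : ℝ) : ℂ :=
  average q d t fun x => (-1 : ℂ) ^ (∑ i, x i)

/-- `‖ξ‖ = (∑_j sin²(πξ_j))^{1/2}`, a 1-periodic function of each coordinate. -/
noncomputable def torusNorm {d : ℕ} (ξ : Fin d → ℝ) : ℝ :=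
  Real.sqrt (∑ j, Real.sin (Real.pi * ξ j) ^ 2)

/-- The translate `ξ + 1/2 = (ξ_1 + 1/2, …, ξ_d + 1/2)`. -/
noncomputable def halfShift {d : ℕ} (ξ : Fin d → ℝ) : Fin d → ℝ :=
  fun j => ξ j + 1 / 2

/-- `κ_q(d, N) = N / d^{1/q}`. -/
noncomputable def kappa (q : ℝ) (d N : ℕ) : ℝ :=
  (N : ℝ) / (d : ℝ) ^ (1 / q)

/-- The value at an integer `0 ≤ x ≤ n` of the normalised Krawtchouk polynomial
of index `0 ≤ k ≤ n`. -/
noncomputable def krawtchouk (n k x : ℕ) : ℝ :=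
  (1 / (n.choose k : ℝ)) *
    ∑ j ∈ Finset.range (k + 1),
      (-1 : ℝ) ^ j * (x.choose j : ℝ) * ((n - x).choose (k - j) : ℝ)

/-- `c ∈ (0, 1)` is an admissible constant in the uniform bound for Krawtchouk polynomials:
`|kr_k^{(n)}(x)| ≤ exp(-ckx/n)` for all `n` and all integers `0 ≤ x, k ≤ n/2`. -/
def IsKrawtchoukConstant (c : ℝ) : Prop :=
  0 < c ∧ c < 1 ∧ ∀ n k x : ℕ, 2 * k ≤ n → 2 * x ≤ n →
    |krawtchouk n k x| ≤ Real.exp (-(c * k * x / n))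

end LqBall

/-!
Averaging over the signs of the coordinates turns `e (x · ξ)` into `∏ i, cos (2π x_i ξ_i)`.

High frequencies. Put `L = t^q`, so that `L / d ≤ exp (-12)`. Comparing an exponential moment with
the `choose d ⌊L⌋` points which have only coordinates `0` and `1`, all but a fraction `1 / L` of the
lattice points have at least `L / 80` coordinates of modulus one. Permuting these `k` coordinates
among the `n ≥ d / 2` coordinates of modulus at most one replaces the factors
`cos (2πξ_i) = 1 - 2 sin² (πξ_i)` by an elementary symmetric polynomial of degree `k` in them. Read
`sin² (πξ_i)` as the probability that a random set contains `i`: the symmetric polynomial becomes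
the mean of a Krawtchouk polynomial of degree `k` at the size of that set, and the bound for the
latter yields the decay.

Low frequencies. Here `1 - ∏ i, cos (2π x_i ξ_i) ≤ 2 ∑ i, x_i² sin² (πξ_i)`, and the mean of `x_i²`
is `O(L / d)` since a unit of a positive coordinate can be transferred to any of at least `d - L`
vanishing ones without leaving the ball. Multiplying by the sign-invariant weight
`(-1)^{x_1 + ⋯ + x_d}` shifts `ξ` by `1 / 2` in each coordinate.

Krawtchouk constants exist because the generating function `(1 - X)^x (1 + X)^{n - x}` satisfies a
differential equation which expresses `kr_{k+1}^{(n+2)}(x)` through `kr_k^{(n)}(x)` and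
`kr_k^{(n)}(x - 2)` with coefficients whose absolute values add up to less than `1`.
-/

namespace LqBall

section Krawtchouk

open Polynomial

/-- The polynomial `(1 - X)^a (1 + X)^b`, whose coefficients are the unnormalised values of the
Krawtchouk polynomials of dimension `a + b` at the point `a`. -/
noncomputable def krawtchoukGen (a b : ℕ) : ℝ[X] := (1 - X) ^ a * (1 + X) ^ b

theorem coeff_one_sub_X_pow {R : Type*} [CommRing R] (a j : ℕ) :
    ((1 - X : R[X]) ^ a).coeff j = (-1) ^ j * (a.choose j : R) := by
  have h : (1 - X : R[X]) ^ a = ((1 + X : R[X]) ^ a).comp (C (-1) * X) := by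
    simp [sub_eq_add_neg]
  rw [h, comp_C_mul_X_coeff, coeff_one_add_X_pow, mul_comm]

theorem coeff_krawtchoukGen (a b k : ℕ) :
    (krawtchoukGen a b).coeff k =
      ∑ j ∈ Finset.range (k + 1), (-1 : ℝ) ^ j * (a.choose j : ℝ) * (b.choose (k - j) : ℝ) := by
  rw [krawtchoukGen, coeff_mul, Finset.Nat.sum_antidiagonal_eq_sum_range_succ_mk]
  exact Finset.sum_congr rfl fun j _ => by rw [coeff_one_sub_X_pow, coeff_one_add_X_pow]

theorem krawtchouk_eq_coeff (n k x : ℕ) :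
    krawtchouk n k x = (krawtchoukGen x (n - x)).coeff k / n.choose k := by
  rw [krawtchouk, coeff_krawtchoukGen]
  ring

theorem krawtchouk_eq_coeff_of_add {a b n : ℕ} (h : a + b = n) (k : ℕ) :
    krawtchouk n k a = (krawtchoukGen a b).coeff k / n.choose k := by
  rw [krawtchouk_eq_coeff, ← h, Nat.add_sub_cancel_left]

theorem abs_krawtchouk_le_one {n x : ℕ} (k : ℕ) (hx : x ≤ n) : |krawtchouk n k x| ≤ 1 := by
  obtain ⟨b, rfl⟩ := Nat.exists_eq_add_of_le hx
  rw [krawtchouk_eq_coeff_of_add rfl, abs_div, Nat.abs_cast, coeff_krawtchoukGen,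
    Nat.add_choose_eq, Finset.Nat.sum_antidiagonal_eq_sum_range_succ_mk]
  refine div_le_one_of_le₀ ?_ (Nat.cast_nonneg _)
  push_cast
  refine (Finset.abs_sum_le_sum_abs _ _).trans_eq (Finset.sum_congr rfl fun j _ => ?_)
  simp [abs_mul]

theorem krawtchouk_sub_right {n x : ℕ} (k : ℕ) (hx : x ≤ n) :
    krawtchouk n k (n - x) = (-1) ^ k * krawtchouk n k x := by
  have h : krawtchoukGen (n - x) x = (krawtchoukGen x (n - x)).comp (C (-1) * X) := by
    simp [krawtchoukGen, sub_eq_add_neg, mul_comm]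
  rw [krawtchouk_eq_coeff_of_add (Nat.sub_add_cancel hx), h, comp_C_mul_X_coeff,
    krawtchouk_eq_coeff]
  ring

theorem krawtchoukGen_ode (a b : ℕ) :
    C ((a : ℝ) + b - 1) * derivative (krawtchoukGen a b)
        - X * derivative (derivative (krawtchoukGen a b)) =
      C ((b : ℝ) * (b - 1)) * krawtchoukGen a (b - 2)
        - C ((a : ℝ) * (a - 1)) * krawtchoukGen (a - 2) b := by
  unfold krawtchoukGen
  rcases a with _ | _ | a <;> rcases b with _ | _ | b <;>
    simp [derivative_pow, map_add, map_mul, map_sub, map_natCast] <;> ring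

theorem coeff_krawtchoukGen_succ (a b k : ℕ) :
    ((k : ℝ) + 1) * (a + b - (k + 1)) * (krawtchoukGen a b).coeff (k + 1) =
      (b : ℝ) * (b - 1) * (krawtchoukGen a (b - 2)).coeff k
        - (a : ℝ) * (a - 1) * (krawtchoukGen (a - 2) b).coeff k := by
  have h := congrArg (fun p => coeff p k) (krawtchoukGen_ode a b)
  simp only [coeff_sub, coeff_C_mul, coeff_derivative] at h
  rw [← h]
  rcases k with _ | k
  · simp
  · simp only [coeff_X_mul, coeff_derivative]
    push_cast
    ring

theorem add_two_choose_succ_mul {n k : ℕ} (hk : k ≤ n) :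
    ((n + 2).choose (k + 1) : ℝ) * ((k + 1) * (n + 1 - k)) = (n + 2) * (n + 1) * n.choose k := by
  have h₁ := Nat.add_one_mul_choose_eq (n + 1) k
  have h₂ := Nat.choose_mul_succ_eq n k
  zify [show k ≤ n + 1 by omega] at h₁ h₂
  have h : ((n + 2).choose (k + 1) : ℤ) * ((k + 1) * (n + 1 - k)) =
      (n + 2) * (n + 1) * n.choose k := by
    linear_combination (-(n + 1 - k : ℤ)) * h₁ - ((n : ℤ) + 2) * h₂
  exact_mod_cast h

theorem krawtchouk_recurrence {n k x : ℕ} (hk : k ≤ n) (hx : x ≤ n + 2) :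
    ((n : ℝ) + 2) * (n + 1) * krawtchouk (n + 2) (k + 1) x =
      ((n : ℝ) + 2 - x) * (n + 1 - x) * krawtchouk n k x
        - (x : ℝ) * (x - 1) * krawtchouk n k (x - 2) := by
  obtain ⟨b, hb⟩ : ∃ b, x + b = n + 2 := ⟨n + 2 - x, by omega⟩
  have hbR : (n : ℝ) + 2 = x + b := by exact_mod_cast hb.symm
  have hpos : (0 : ℝ) < n.choose k := by exact_mod_cast Nat.choose_pos hk
  have hpos' : (0 : ℝ) < (n + 2).choose (k + 1) := by exact_mod_cast Nat.choose_pos (by omega)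
  have hleft : (b : ℝ) * (b - 1) * krawtchouk n k x =
      (b : ℝ) * (b - 1) * (krawtchoukGen x (b - 2)).coeff k / n.choose k := by
    rcases b with _ | _ | b
    · simp
    · simp
    · rw [krawtchouk_eq_coeff_of_add (show x + b = n by omega), show b + 1 + 1 - 2 = b from rfl]
      ring
  have hright : (x : ℝ) * (x - 1) * krawtchouk n k (x - 2) =
      (x : ℝ) * (x - 1) * (krawtchoukGen (x - 2) b).coeff k / n.choose k := by
    rcases x with _ | _ | x
    · simp
    · simp
    · rw [krawtchouk_eq_coeff_of_add (show x + 1 + 1 - 2 + b = n by omega)]; ring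
  rw [show (n : ℝ) + 2 - x = b by linarith, show (n : ℝ) + 1 - x = b - 1 by linarith, hleft, hright,
    ← sub_div, ← coeff_krawtchoukGen_succ, ← hbR, krawtchouk_eq_coeff_of_add hb, ← mul_div_assoc,
    div_eq_div_iff hpos'.ne' hpos.ne']
  linear_combination (-(krawtchoukGen x b).coeff (k + 1)) * add_two_choose_succ_mul hk

theorem mul_abs_krawtchouk_succ_le {n k x : ℕ} {β : ℝ} (hk : k ≤ n) (hx : x ≤ n + 2)
    (h₀ : x ≤ n → |krawtchouk n k x| ≤ β) (h₂ : 2 ≤ x → |krawtchouk n k (x - 2)| ≤ β) :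
    ((n : ℝ) + 2) * (n + 1) * |krawtchouk (n + 2) (k + 1) x| ≤
      (((n : ℝ) + 2) * (n + 1) - 2 * x * (n + 2 - x)) * β := by
  have abs_mul_le : ∀ (m : ℕ) {y : ℝ}, (2 ≤ m → |y| ≤ β) →
      |(m : ℝ) * (m - 1) * y| ≤ m * (m - 1) * β := by
    rintro (_ | _ | m) y hy
    · simp
    · simp
    · have hm : (0 : ℝ) ≤ (m + 1 + 1 : ℕ) * ((m + 1 + 1 : ℕ) - 1) := by
        push_cast; ring_nf; positivity
      rw [abs_mul, abs_of_nonneg hm]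
      exact mul_le_mul_of_nonneg_left (hy (by omega)) hm
  have hleft := abs_mul_le (n + 2 - x) (y := krawtchouk n k x) fun h => h₀ (by omega)
  rw [Nat.cast_sub hx] at hleft
  push_cast at hleft
  calc ((n : ℝ) + 2) * (n + 1) * |krawtchouk (n + 2) (k + 1) x|
      = |((n : ℝ) + 2 - x) * (n + 2 - x - 1) * krawtchouk n k x
          - (x : ℝ) * (x - 1) * krawtchouk n k (x - 2)| := by
        rw [show (n : ℝ) + 2 - x - 1 = n + 1 - x by ring, ← krawtchouk_recurrence hk hx, abs_mul,
          abs_of_nonneg (show 0 ≤ ((n : ℝ) + 2) * (n + 1) by positivity)]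
    _ ≤ ((n : ℝ) + 2 - x) * (n + 2 - x - 1) * β + x * (x - 1) * β :=
        (abs_sub _ _).trans (add_le_add hleft (abs_mul_le x h₂))
    _ = _ := by ring

/-- Each application of the recurrence lowers `x` or `n - x` by two; as long as these stay above
`A` and `D`, it gains a factor `1 - 2AD/M²`. -/
theorem abs_krawtchouk_le_pow {A D M : ℝ} (hA : 0 ≤ A) (hD : 0 ≤ D) (m : ℕ) :
    ∀ n k x : ℕ, x ≤ n → m ≤ k → m + k ≤ n → A + 2 * m ≤ x + 2 → D + 2 * m ≤ n - x + 2 →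
      n ≤ M → |krawtchouk n k x| ≤ (1 - 2 * A * D / M ^ 2) ^ m := by
  induction m with
  | zero => intro n k x hx _ _ _ _ _; simpa using abs_krawtchouk_le_one k hx
  | succ m ih =>
    intro n k x hx hk hkn hAx hDx hM
    obtain ⟨k, rfl⟩ : ∃ k', k = k' + 1 := ⟨k - 1, by omega⟩
    obtain ⟨n, rfl⟩ : ∃ n', n = n' + 2 := ⟨n - 2, by omega⟩
    push_cast at hAx hDx hM
    set r := 1 - 2 * A * D / M ^ 2 with hr
    have hM₀ : 0 < M := by linarith [n.cast_nonneg (α := ℝ)]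
    have hAD : A * D ≤ x * (n + 2 - x) := by
      have := m.cast_nonneg (α := ℝ)
      exact mul_le_mul (by linarith) (by linarith) hD x.cast_nonneg
    have hr₀ : 0 ≤ r := by
      rw [hr, sub_nonneg, div_le_one (by positivity)]
      nlinarith [sq_nonneg ((n : ℝ) + 2 - 2 * x)]
    have hgain : ((n : ℝ) + 2) * (n + 1) - 2 * x * (n + 2 - x) ≤ ((n : ℝ) + 2) * (n + 1) * r := by
      have hnM : ((n : ℝ) + 2) * (n + 1) ≤ M ^ 2 := by nlinarith [n.cast_nonneg (α := ℝ)]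
      have : 2 * A * D / M ^ 2 * (((n : ℝ) + 2) * (n + 1)) ≤ 2 * (A * D) := by
        rw [div_mul_eq_mul_div, div_le_iff₀ (by positivity), mul_assoc 2 A D]
        exact mul_le_mul_of_nonneg_left hnM (by positivity)
      rw [hr]
      linarith
    have hrec := mul_abs_krawtchouk_succ_le (by omega) hx (β := r ^ m)
      (fun h => ih n k x h (by omega) (by omega) (by linarith) (by linarith) (by linarith))
      (fun h => ih n k (x - 2) (by omega) (by omega) (by omega)
        (by rw [Nat.cast_sub h]; push_cast; linarith)
        (by rw [Nat.cast_sub h]; push_cast; linarith) (by linarith))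
    refine le_of_mul_le_mul_left (hrec.trans ?_) (show 0 < ((n : ℝ) + 2) * (n + 1) by positivity)
    rw [pow_succ', ← mul_assoc]
    exact mul_le_mul_of_nonneg_right hgain (pow_nonneg hr₀ m)

theorem choose_mul_choose_sub_comm (n a b : ℕ) :
    n.choose a * (n - a).choose b = n.choose b * (n - b).choose a := by
  have h₁ := Nat.choose_mul (n := n) (Nat.le_add_right a b)
  have h₂ := Nat.choose_mul (n := n) (Nat.le_add_left b a)
  rw [Nat.add_sub_cancel_left] at h₁
  rw [Nat.add_sub_cancel] at h₂
  rw [← h₁, ← h₂, Nat.choose_symm_add]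

theorem choose_mul_choose_mul_choose_comm {n k x j : ℕ} (hjk : j ≤ k) (hjx : j ≤ x) :
    n.choose x * (x.choose j * (n - x).choose (k - j)) =
      n.choose k * (k.choose j * (n - k).choose (x - j)) := by
  have h := choose_mul_choose_sub_comm (n - j) (x - j) (k - j)
  rw [show n - j - (x - j) = n - x by omega, show n - j - (k - j) = n - k by omega] at h
  rw [← mul_assoc, ← mul_assoc, Nat.choose_mul hjx, Nat.choose_mul hjk, mul_assoc, mul_assoc, h]

theorem sum_range_choose_eq_sum_range_min (n k x : ℕ) :
    ∑ j ∈ Finset.range (k + 1), (-1 : ℝ) ^ j * x.choose j * (n - x).choose (k - j) =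
      ∑ j ∈ Finset.range (min k x + 1), (-1 : ℝ) ^ j * x.choose j * (n - x).choose (k - j) := by
  refine (Finset.sum_subset (Finset.range_mono (by omega)) fun j hj hj' => ?_).symm
  simp only [Finset.mem_range] at hj hj'
  rw [Nat.choose_eq_zero_of_lt (by omega : x < j)]
  simp

theorem krawtchouk_symm {n k x : ℕ} (hk : k ≤ n) (hx : x ≤ n) :
    krawtchouk n k x = krawtchouk n x k := by
  have hk₀ : (n.choose k : ℝ) ≠ 0 := by exact_mod_cast (Nat.choose_pos hk).ne'
  have hx₀ : (n.choose x : ℝ) ≠ 0 := by exact_mod_cast (Nat.choose_pos hx).ne'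
  rw [krawtchouk, krawtchouk, sum_range_choose_eq_sum_range_min n k x,
    sum_range_choose_eq_sum_range_min n x k, min_comm x k, ← mul_div_right_comm,
    ← mul_div_right_comm, one_mul, one_mul, div_eq_div_iff hk₀ hx₀, Finset.sum_mul, Finset.sum_mul]
  refine Finset.sum_congr rfl fun j hj => ?_
  simp only [Finset.mem_range] at hj
  have h : (n.choose x : ℝ) * (x.choose j * (n - x).choose (k - j)) =
      n.choose k * (k.choose j * (n - k).choose (x - j)) := by
    exact_mod_cast choose_mul_choose_mul_choose_comm (by omega : j ≤ k) (by omega : j ≤ x)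
  linear_combination (-1 : ℝ) ^ j * h

theorem abs_krawtchouk_le_exp_of_le {n k x : ℕ} (hx : 2 * x ≤ n) (hkx : k ≤ x) :
    |krawtchouk n k x| ≤ Real.exp (-(1 / 16 * k * x / n)) := by
  rcases Nat.eq_zero_or_pos k with rfl | hk₀
  · simpa using abs_krawtchouk_le_one 0 (by omega : x ≤ n)
  obtain ⟨m, hkm, hmk⟩ : ∃ m : ℕ, k ≤ 4 * m ∧ 4 * m ≤ k + 3 := ⟨(k + 3) / 4, by omega, by omega⟩
  have hxn : x ≤ n := by omega
  have hm : m ≤ k ∧ m + k ≤ n := by omega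
  rify at hx hkx hk₀ hkm hmk
  have hn₀ : (0 : ℝ) < n := by linarith
  have h := abs_krawtchouk_le_pow (A := (x : ℝ) / 2) (D := (n : ℝ) / 4) (M := n)
    (by positivity) (by positivity) m n k x hxn hm.1 hm.2 (by linarith) (by linarith) le_rfl
  rw [show 2 * ((x : ℝ) / 2) * ((n : ℝ) / 4) / (n : ℝ) ^ 2 = x / (4 * n) by field_simp] at h
  have hx4 : (x : ℝ) / (4 * n) ≤ 1 := by rw [div_le_one (by positivity)]; linarith
  calc |krawtchouk n k x| ≤ (1 - (x : ℝ) / (4 * n)) ^ m := h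
    _ ≤ Real.exp (-((x : ℝ) / (4 * n))) ^ m :=
        pow_le_pow_left₀ (sub_nonneg.2 hx4) (Real.one_sub_le_exp_neg _) m
    _ = Real.exp (-(m * ((x : ℝ) / (4 * n)))) := by rw [← Real.exp_nat_mul, mul_neg]
    _ ≤ Real.exp (-(k / 4 * ((x : ℝ) / (4 * n)))) := by gcongr; linarith
    _ = _ := by congr 1; field_simp; ring

theorem isKrawtchoukConstant_one_div_sixteen : IsKrawtchoukConstant (1 / 16) := by
  refine ⟨by norm_num, by norm_num, fun n k x hk hx => ?_⟩
  rcases le_total k x with h | h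
  · exact abs_krawtchouk_le_exp_of_le hx h
  · rw [krawtchouk_symm (by omega) (by omega), mul_right_comm]
    exact abs_krawtchouk_le_exp_of_le hk h

theorem IsKrawtchoukConstant.abs_krawtchouk_le_add {c : ℝ} (hc : IsKrawtchoukConstant c)
    {n k x : ℕ} (hk : 2 * k ≤ n) (hx : x ≤ n) :
    |krawtchouk n k x| ≤ Real.exp (-(c * k / n)) ^ x + Real.exp (-(c * k / n)) ^ (n - x) := by
  have near : ∀ y : ℕ, 2 * y ≤ n → |krawtchouk n k y| ≤ Real.exp (-(c * k / n)) ^ y := by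
    intro y hy
    rw [← Real.exp_nat_mul]
    exact (hc.2.2 n k y hk hy).trans_eq (by ring_nf)
  rcases le_total (2 * x) n with h | h
  · exact (near x h).trans (le_add_of_nonneg_right (by positivity))
  · have hreflect : |krawtchouk n k (n - x)| = |krawtchouk n k x| := by
      rw [krawtchouk_sub_right k hx, abs_mul, abs_pow, abs_neg, abs_one, one_pow, one_mul]
    rw [← hreflect]
    exact (near (n - x) (by omega)).trans (le_add_of_nonneg_left (by positivity))

end Krawtchouk

section RandomSubset

variable {ι : Type*} [DecidableEq ι]

/-- The probability that the random subset of `V` which contains each `i` independently with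
probability `p i` equals `T`. -/
noncomputable def bernoulliWeight (V T : Finset ι) (p : ι → ℝ) : ℝ :=
  (∏ i ∈ T, p i) * ∏ i ∈ V \ T, (1 - p i)

theorem bernoulliWeight_nonneg (V T : Finset ι) {p : ι → ℝ} (hp₀ : ∀ i, 0 ≤ p i)
    (hp₁ : ∀ i, p i ≤ 1) : 0 ≤ bernoulliWeight V T p :=
  mul_nonneg (Finset.prod_nonneg fun i _ => hp₀ i)
    (Finset.prod_nonneg fun i _ => sub_nonneg.2 (hp₁ i))

theorem bernoulliWeight_sdiff {V T : Finset ι} (hT : T ⊆ V) (p : ι → ℝ) :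
    bernoulliWeight V (V \ T) p = bernoulliWeight V T fun i => 1 - p i := by
  simp only [bernoulliWeight, Finset.sdiff_sdiff_eq_self hT, sub_sub_cancel, mul_comm]

theorem sum_bernoulliWeight_mul_pow {V I : Finset ι} (hI : I ⊆ V) (p : ι → ℝ) (β : ℝ) :
    ∑ T ∈ V.powerset, bernoulliWeight V T p * β ^ (I ∩ T).card =
      ∏ i ∈ I, (1 - p i * (1 - β)) := by
  symm
  calc ∏ i ∈ I, (1 - p i * (1 - β))
      = ∏ i ∈ V, (p i * (if i ∈ I then β else 1) + (1 - p i)) := by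
        rw [← Finset.prod_subset hI fun i _ hi => by rw [if_neg hi]; ring]
        exact Finset.prod_congr rfl fun i hi => by rw [if_pos hi]; ring
    _ = _ := by
        rw [Finset.prod_add]
        refine Finset.sum_congr rfl fun T _ => ?_
        rw [Finset.prod_mul_distrib, Finset.prod_ite, Finset.prod_const, Finset.prod_const_one,
          Finset.filter_mem_eq_inter, Finset.inter_comm, bernoulliWeight]
        ring

theorem sum_bernoulliWeight_mul_pow_card (V : Finset ι) (p : ι → ℝ) (β : ℝ) :
    ∑ T ∈ V.powerset, bernoulliWeight V T p * β ^ T.card = ∏ i ∈ V, (1 - p i * (1 - β)) := by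
  rw [← sum_bernoulliWeight_mul_pow subset_rfl]
  refine Finset.sum_congr rfl fun T hT => ?_
  rw [Finset.inter_eq_right.2 (Finset.mem_powerset.1 hT)]

theorem sum_bernoulliWeight_mul_pow_card_sdiff (V : Finset ι) (p : ι → ℝ) (β : ℝ) :
    ∑ T ∈ V.powerset, bernoulliWeight V T p * β ^ (V \ T).card =
      ∏ i ∈ V, (1 - (1 - p i) * (1 - β)) := by
  rw [← sum_bernoulliWeight_mul_pow_card V fun i => 1 - p i]
  refine Finset.sum_nbij' (V \ ·) (V \ ·) (by simp) (by simp) (by simp) (by simp) fun T hT => ?_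
  rw [← bernoulliWeight_sdiff Finset.sdiff_subset,
    Finset.sdiff_sdiff_eq_self (Finset.mem_powerset.1 hT)]

theorem sum_powersetCard_prod_eq_sum_bernoulliWeight (V : Finset ι) (k : ℕ) (p : ι → ℝ) (β : ℝ) :
    ∑ I ∈ V.powersetCard k, ∏ i ∈ I, (1 - p i * (1 - β)) =
      ∑ T ∈ V.powerset, bernoulliWeight V T p *
        ∑ I ∈ V.powersetCard k, β ^ (I ∩ T).card := by
  simp only [Finset.mul_sum]
  rw [Finset.sum_comm]
  refine Finset.sum_congr rfl fun I hI => ?_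
  rw [sum_bernoulliWeight_mul_pow (Finset.mem_powersetCard.1 hI).1]

open Polynomial in
theorem sum_powersetCard_pow_card_inter {V T : Finset ι} (hT : T ⊆ V) (k : ℕ) (β : ℝ) :
    ∑ I ∈ V.powersetCard k, β ^ (I ∩ T).card =
      ((1 + C β * X : ℝ[X]) ^ T.card * (1 + X) ^ (V \ T).card).coeff k := by
  have hprod : (1 + C β * X : ℝ[X]) ^ T.card * (1 + X) ^ (V \ T).card =
      ∏ i ∈ V, (1 + C (if i ∈ T then β else 1) * X) := by
    rw [← Finset.prod_sdiff hT, mul_comm, ← Finset.prod_const, ← Finset.prod_const]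
    congr 1
    · exact Finset.prod_congr rfl fun i hi => by
        rw [if_neg (Finset.mem_sdiff.1 hi).2, C_1, one_mul]
    · exact Finset.prod_congr rfl fun i hi => by rw [if_pos hi]
  rw [hprod, Finset.prod_one_add, finsetSum_coeff, Finset.powersetCard_eq_filter,
    Finset.sum_filter]
  refine Finset.sum_congr rfl fun I _ => ?_
  rw [Finset.prod_mul_distrib, Finset.prod_const, ← map_prod, coeff_C_mul_X_pow, Finset.prod_ite,
    Finset.prod_const, Finset.prod_const_one, mul_one, Finset.filter_mem_eq_inter]
  simp only [eq_comm]

theorem sum_powersetCard_neg_one_pow_card_inter {V T : Finset ι} (hT : T ⊆ V) {k : ℕ}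
    (hk : k ≤ V.card) :
    ∑ I ∈ V.powersetCard k, (-1 : ℝ) ^ (I ∩ T).card =
      V.card.choose k * krawtchouk V.card k T.card := by
  have hchoose : (V.card.choose k : ℝ) ≠ 0 := by exact_mod_cast (Nat.choose_pos hk).ne'
  rw [sum_powersetCard_pow_card_inter hT, krawtchouk_eq_coeff, mul_div_cancel₀ _ hchoose,
    krawtchoukGen, Finset.card_sdiff_of_subset hT, Polynomial.C_neg, Polynomial.C_1, neg_one_mul,
    ← sub_eq_add_neg]

theorem sum_powersetCard_zero_pow_card_inter {V T : Finset ι} (hT : T ⊆ V) (k : ℕ) :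
    ∑ I ∈ V.powersetCard k, (0 : ℝ) ^ (I ∩ T).card = (V.card - T.card).choose k := by
  rw [sum_powersetCard_pow_card_inter hT, Polynomial.C_0, zero_mul, add_zero, one_pow, one_mul,
    Polynomial.coeff_one_add_X_pow, Finset.card_sdiff_of_subset hT]

end RandomSubset

section ElementarySymmetric

variable {ι : Type*}

theorem IsKrawtchoukConstant.abs_sum_powersetCard_le {c : ℝ} (hc : IsKrawtchoukConstant c)
    (V : Finset ι) {k : ℕ} (hk : 2 * k ≤ V.card) {p : ι → ℝ}
    (hp₀ : ∀ i, 0 ≤ p i) (hp₁ : ∀ i, p i ≤ 1) :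
    |∑ I ∈ V.powersetCard k, ∏ i ∈ I, (1 - 2 * p i)| ≤
      (V.card.choose k : ℝ) *
        (∏ i ∈ V, (1 - p i * (1 - Real.exp (-(c * k / V.card)))) +
          ∏ i ∈ V, (1 - (1 - p i) * (1 - Real.exp (-(c * k / V.card))))) := by
  classical
  set r := Real.exp (-(c * k / V.card))
  have hsum := sum_powersetCard_prod_eq_sum_bernoulliWeight V k p (-1)
  simp only [show ∀ i, 1 - p i * (1 - -1) = 1 - 2 * p i from fun i => by ring] at hsum
  calc |∑ I ∈ V.powersetCard k, ∏ i ∈ I, (1 - 2 * p i)|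
      ≤ ∑ T ∈ V.powerset, bernoulliWeight V T p *
          (V.card.choose k * (r ^ T.card + r ^ (V \ T).card)) := by
        rw [hsum]
        refine (Finset.abs_sum_le_sum_abs _ _).trans (Finset.sum_le_sum fun T hT => ?_)
        have hTV := Finset.mem_powerset.1 hT
        rw [abs_mul, abs_of_nonneg (bernoulliWeight_nonneg V T hp₀ hp₁),
          sum_powersetCard_neg_one_pow_card_inter hTV (by omega), abs_mul, Nat.abs_cast,
          Finset.card_sdiff_of_subset hTV]
        gcongr
        · exact bernoulliWeight_nonneg V T hp₀ hp₁
        · exact hc.abs_krawtchouk_le_add hk (Finset.card_le_card hTV)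
    _ = _ := by
        rw [← sum_bernoulliWeight_mul_pow_card, ← sum_bernoulliWeight_mul_pow_card_sdiff,
          ← Finset.sum_add_distrib, Finset.mul_sum]
        exact Finset.sum_congr rfl fun T _ => by ring

theorem two_pow_mul_choose_sub_le {d n t : ℕ} (hd : d ≤ 2 * n) (ht : t ≤ d) :
    2 ^ t * (d - t).choose n ≤ d.choose n := by
  induction t with
  | zero => simp
  | succ t ih =>
    obtain ⟨m, hm⟩ : ∃ m, d - t = m + 1 := ⟨d - t - 1, by omega⟩
    obtain ⟨n, rfl⟩ : ∃ n', n = n' + 1 := ⟨n - 1, by omega⟩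
    have hpascal : m.choose (n + 1) ≤ m.choose n := by
      refine Nat.le_of_mul_le_mul_right ((Nat.choose_succ_right_eq m n).trans_le ?_) n.succ_pos
      exact Nat.mul_le_mul_left _ (by omega)
    calc 2 ^ (t + 1) * (d - (t + 1)).choose (n + 1)
        = 2 ^ t * (m.choose (n + 1) + m.choose (n + 1)) := by
          rw [show d - (t + 1) = m by omega]; ring
      _ ≤ 2 ^ t * (m.choose n + m.choose (n + 1)) := by gcongr
      _ = 2 ^ t * (d - t).choose (n + 1) := by rw [hm, Nat.choose_succ_succ]
      _ ≤ d.choose (n + 1) := ih (by omega)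

theorem sum_powersetCard_prod_one_sub_le (V : Finset ι) {n : ℕ} (hn : V.card ≤ 2 * n)
    {u : ι → ℝ} (hu₀ : ∀ i, 0 ≤ u i) (hu₁ : ∀ i, u i ≤ 1) :
    ∑ U ∈ V.powersetCard n, ∏ i ∈ U, (1 - u i) ≤
      (V.card.choose n : ℝ) * ∏ i ∈ V, (1 - u i / 2) := by
  classical
  have hsum := sum_powersetCard_prod_eq_sum_bernoulliWeight V n u 0
  have hprod := sum_bernoulliWeight_mul_pow_card V u (1 / 2)
  simp only [sub_zero, mul_one] at hsum
  simp only [show ∀ i, 1 - u i * (1 - 1 / 2) = 1 - u i / 2 from fun i => by ring] at hprod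
  rw [hsum, ← hprod, Finset.mul_sum]
  refine Finset.sum_le_sum fun T hT => ?_
  rw [Finset.mem_powerset] at hT
  rw [mul_left_comm, sum_powersetCard_zero_pow_card_inter hT]
  refine mul_le_mul_of_nonneg_left ?_ (bernoulliWeight_nonneg V T hu₀ hu₁)
  rw [one_div, inv_pow, ← div_eq_mul_inv, le_div_iff₀' (by positivity)]
  exact_mod_cast two_pow_mul_choose_sub_le hn (Finset.card_le_card hT)

theorem half_le_one_sub_exp_neg {a : ℝ} (ha₀ : 0 ≤ a) (ha₁ : a ≤ 1) :
    a / 2 ≤ 1 - Real.exp (-a) := by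
  have hmul : Real.exp (-a) * (1 + a) ≤ 1 := by
    rw [Real.exp_neg, inv_mul_le_one₀ (Real.exp_pos a), add_comm]
    exact Real.add_one_le_exp a
  nlinarith [Real.exp_pos (-a)]

theorem sum_powersetCard_prod_le_exp (V : Finset ι) {n : ℕ} (hn : V.card ≤ 2 * n) {p : ι → ℝ}
    (hp₀ : ∀ i, 0 ≤ p i) (hp₁ : ∀ i, p i ≤ 1) {a : ℝ} (ha₀ : 0 ≤ a) (ha₁ : a ≤ 1) :
    ∑ U ∈ V.powersetCard n, ∏ i ∈ U, (1 - p i * (1 - Real.exp (-a))) ≤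
      (V.card.choose n : ℝ) * Real.exp (-(a / 4 * ∑ i ∈ V, p i)) := by
  have hb := half_le_one_sub_exp_neg ha₀ ha₁
  have hb₀ : 0 ≤ 1 - Real.exp (-a) := by linarith
  have hu₁ : ∀ i, p i * (1 - Real.exp (-a)) ≤ 1 := fun i =>
    mul_le_one₀ (hp₁ i) hb₀ (by linarith [Real.exp_pos (-a)])
  refine (sum_powersetCard_prod_one_sub_le V hn (fun i => mul_nonneg (hp₀ i) hb₀) hu₁).trans ?_
  rw [Finset.mul_sum, ← Finset.sum_neg_distrib, Real.exp_sum]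
  gcongr with i
  · intro i _
    linarith [hu₁ i]
  · refine le_trans ?_ (Real.one_sub_le_exp_neg _)
    nlinarith [hp₀ i]

/-- On a fixed `U` the products `∏ i ∈ U, (1 - p i * (1 - r))` need not decay in `∑ i ∈ V, p i`;
averaging over the `n`-subsets `U` of `V` restores the sum over all of `V`. -/
theorem IsKrawtchoukConstant.sum_abs_sum_powersetCard_le {c : ℝ} (hc : IsKrawtchoukConstant c)
    (V : Finset ι) {n k : ℕ} (hn : V.card ≤ 2 * n) (hk : 2 * k ≤ n) {p : ι → ℝ}
    (hp₀ : ∀ i, 0 ≤ p i) (hp₁ : ∀ i, p i ≤ 1) :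
    ∑ U ∈ V.powersetCard n, |∑ I ∈ U.powersetCard k, ∏ i ∈ I, (1 - 2 * p i)| ≤
      (V.card.choose n : ℝ) * n.choose k *
        (Real.exp (-(c * k / n / 4 * ∑ i ∈ V, p i)) +
          Real.exp (-(c * k / n / 4 * ∑ i ∈ V, (1 - p i)))) := by
  have hc₀ := hc.1
  have ha₀ : 0 ≤ c * k / n := by positivity
  have ha₁ : c * k / n ≤ 1 := by
    have hkn : (k : ℝ) ≤ n := by exact_mod_cast (by omega : k ≤ n)
    exact div_le_one_of_le₀ ((mul_le_of_le_one_left k.cast_nonneg hc.2.1.le).trans hkn)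
      n.cast_nonneg
  have hp := sum_powersetCard_prod_le_exp V hn hp₀ hp₁ ha₀ ha₁
  have hp' := sum_powersetCard_prod_le_exp V hn (fun i => sub_nonneg.2 (hp₁ i))
    (fun i => sub_le_self 1 (hp₀ i)) ha₀ ha₁
  calc ∑ U ∈ V.powersetCard n, |∑ I ∈ U.powersetCard k, ∏ i ∈ I, (1 - 2 * p i)|
      ≤ ∑ U ∈ V.powersetCard n, (n.choose k : ℝ) *
        (∏ i ∈ U, (1 - p i * (1 - Real.exp (-(c * k / n)))) +
          ∏ i ∈ U, (1 - (1 - p i) * (1 - Real.exp (-(c * k / n))))) := by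
        refine Finset.sum_le_sum fun U hU => ?_
        obtain ⟨-, rfl⟩ := Finset.mem_powersetCard.1 hU
        exact hc.abs_sum_powersetCard_le U hk hp₀ hp₁
    _ ≤ _ := by
        rw [← Finset.mul_sum, Finset.sum_add_distrib, mul_comm (V.card.choose n : ℝ), mul_assoc,
          mul_add (V.card.choose n : ℝ)]
        gcongr

end ElementarySymmetric

section Symmetry

variable {ι : Type*} {B : Finset (ι → ℤ)}

/-- Invariance of a finite set of lattice points under all changes of signs of the coordinates. -/
def IsSignInvariant (B : Finset (ι → ℤ)) : Prop := ∀ ε : ι → ℤˣ, ∀ x ∈ B, ε • x ∈ B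

/-- Invariance of a finite set of lattice points under all permutations of the coordinates. -/
def IsPermInvariant (B : Finset (ι → ℤ)) : Prop := ∀ σ : Equiv.Perm ι, ∀ x ∈ B, x ∘ σ ∈ B

theorem IsSignInvariant.sum_smul (hB : IsSignInvariant B) {M : Type*} [AddCommMonoid M]
    (g : (ι → ℤ) → M) (ε : ι → ℤˣ) : ∑ x ∈ B, g (ε • x) = ∑ x ∈ B, g x :=
  Finset.sum_nbij' (ε • ·) (ε⁻¹ • ·) (hB ε) (hB ε⁻¹) (fun x _ => inv_smul_smul ε x)
    (fun x _ => smul_inv_smul ε x) fun _ _ => rfl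

theorem IsPermInvariant.comp_mem_iff (hB : IsPermInvariant B) (σ : Equiv.Perm ι) {x : ι → ℤ} :
    x ∘ σ ∈ B ↔ x ∈ B :=
  ⟨fun h => by simpa [Function.comp_assoc] using hB σ.symm _ h, hB σ x⟩

variable [Fintype ι]

/-- `∏ i, cos (2π x_i ξ_i)`, the average of the exponential `e (x · ξ)` over all changes of signs of
the coordinates of `x`. -/
noncomputable def cosProd (ξ : ι → ℝ) (x : ι → ℤ) : ℝ :=
  ∏ i, Real.cos (2 * Real.pi * (x i * ξ i))

theorem abs_cosProd_le_one (ξ : ι → ℝ) (x : ι → ℤ) : |cosProd ξ x| ≤ 1 := by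
  rw [cosProd, Finset.abs_prod]
  exact Finset.prod_le_one (fun i _ => abs_nonneg _) fun i _ => Real.abs_cos_le_one _

theorem e_sum (s : ι → ℝ) : e (∑ i, s i) = ∏ i, e (s i) := by
  simp only [e, ← Complex.exp_sum, Complex.ofReal_sum, Finset.mul_sum]

theorem e_add_e_neg (s : ℝ) : e s + e (-s) = 2 * (Real.cos (2 * Real.pi * s) : ℂ) := by
  simp only [e]
  push_cast
  rw [Complex.two_cos]
  congr 2 <;> ring

variable [DecidableEq ι]

theorem sum_units_e (ξ : ι → ℝ) (x : ι → ℤ) :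
    ∑ ε : ι → ℤˣ, e (∑ i, ((ε • x) i : ℝ) * ξ i) = 2 ^ Fintype.card ι * (cosProd ξ x : ℂ) := by
  have hcoord : ∀ i, ∑ u : ℤˣ, e ((u • x i : ℤ) * ξ i) =
      2 * (Real.cos (2 * Real.pi * (x i * ξ i)) : ℂ) := by
    intro i
    rw [← e_add_e_neg, UnitsInt.univ, Finset.sum_pair (by decide)]
    simp
  calc ∑ ε : ι → ℤˣ, e (∑ i, ((ε • x) i : ℝ) * ξ i)
      = ∑ ε : ι → ℤˣ, ∏ i, e ((ε i • x i : ℤ) * ξ i) := by simp only [e_sum, Pi.smul_apply']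
    _ = ∏ i, ∑ u : ℤˣ, e ((u • x i : ℤ) * ξ i) := by
        rw [Finset.prod_univ_sum, Fintype.piFinset_univ]
    _ = _ := by
        rw [Finset.prod_congr rfl fun i _ => hcoord i, Finset.prod_mul_distrib, Finset.prod_const,
          Finset.card_univ, cosProd, Complex.ofReal_prod]

omit [DecidableEq ι] in
theorem IsSignInvariant.sum_mul_e (hB : IsSignInvariant B) {s : (ι → ℤ) → ℂ}
    (hs : ∀ (ε : ι → ℤˣ) x, s (ε • x) = s x) (ξ : ι → ℝ) :
    ∑ x ∈ B, s x * e (∑ i, (x i : ℝ) * ξ i) = ∑ x ∈ B, s x * (cosProd ξ x : ℂ) := by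
  classical
  have hcard : ∑ _ε : ι → ℤˣ, (1 : ℂ) = 2 ^ Fintype.card ι := by simp
  refine mul_left_cancel₀ (pow_ne_zero (Fintype.card ι) (two_ne_zero (α := ℂ))) ?_
  calc 2 ^ Fintype.card ι * ∑ x ∈ B, s x * e (∑ i, (x i : ℝ) * ξ i)
      = ∑ ε : ι → ℤˣ, ∑ x ∈ B, s (ε • x) * e (∑ i, ((ε • x) i : ℝ) * ξ i) := by
        rw [← hcard, Finset.sum_mul]
        refine Finset.sum_congr rfl fun ε _ => ?_
        rw [one_mul, hB.sum_smul fun x => s x * e (∑ i, (x i : ℝ) * ξ i)]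
    _ = ∑ x ∈ B, s x * ∑ ε : ι → ℤˣ, e (∑ i, ((ε • x) i : ℝ) * ξ i) := by
        rw [Finset.sum_comm]
        simp only [hs, Finset.mul_sum]
    _ = _ := by simp only [sum_units_e, Finset.mul_sum, mul_left_comm]

end Symmetry

section LowFrequency

theorem abs_one_sub_prod_le {ι : Type*} (s : Finset ι) {a : ι → ℝ} (ha : ∀ i, |a i| ≤ 1) :
    |1 - ∏ i ∈ s, a i| ≤ ∑ i ∈ s, (1 - a i) := by
  classical
  induction s using Finset.induction_on with
  | empty => simp
  | insert i s hi ih =>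
    rw [Finset.prod_insert hi, Finset.sum_insert hi]
    calc |1 - a i * ∏ j ∈ s, a j| = |(1 - a i) + a i * (1 - ∏ j ∈ s, a j)| := by congr 1; ring
      _ ≤ |1 - a i| + |a i| * |1 - ∏ j ∈ s, a j| := by rw [← abs_mul]; exact abs_add_le _ _
      _ ≤ (1 - a i) + ∑ j ∈ s, (1 - a j) := by
        refine add_le_add (abs_of_nonneg (sub_nonneg.2 (abs_le.1 (ha i)).2)).le ?_
        exact (mul_le_of_le_one_left (abs_nonneg _) (ha i)).trans ih

theorem abs_sin_natCast_mul_le (n : ℕ) (θ : ℝ) : |Real.sin (n * θ)| ≤ n * |Real.sin θ| := by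
  induction n with
  | zero => simp
  | succ n ih =>
    calc |Real.sin ((n + 1 : ℕ) * θ)|
        = |Real.sin (n * θ) * Real.cos θ + Real.cos (n * θ) * Real.sin θ| := by
          rw [← Real.sin_add]; push_cast; ring_nf
      _ ≤ |Real.sin (n * θ)| * |Real.cos θ| + |Real.cos (n * θ)| * |Real.sin θ| := by
          rw [← abs_mul, ← abs_mul]; exact abs_add_le _ _
      _ ≤ n * |Real.sin θ| + |Real.sin θ| :=
          add_le_add ((mul_le_of_le_one_right (abs_nonneg _) (Real.abs_cos_le_one _)).trans ih)
            (mul_le_of_le_one_left (abs_nonneg _) (Real.abs_cos_le_one _))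
      _ = _ := by push_cast; ring

theorem sin_intCast_mul_sq_le (m : ℤ) (θ : ℝ) :
    Real.sin (m * θ) ^ 2 ≤ (m : ℝ) ^ 2 * Real.sin θ ^ 2 := by
  rw [← mul_pow, sq_le_sq, abs_mul]
  obtain ⟨n, rfl | rfl⟩ := Int.eq_nat_or_neg m
  · simpa using abs_sin_natCast_mul_le n θ
  · simpa using abs_sin_natCast_mul_le n θ

theorem one_sub_cos_le (m : ℤ) (ξ : ℝ) :
    1 - Real.cos (2 * Real.pi * (m * ξ)) ≤ 2 * ((m : ℝ) ^ 2 * Real.sin (Real.pi * ξ) ^ 2) := by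
  have h := sin_intCast_mul_sq_le m (Real.pi * ξ)
  have hcos := Real.cos_two_mul' ((m : ℝ) * (Real.pi * ξ))
  have hsq := Real.sin_sq_add_cos_sq ((m : ℝ) * (Real.pi * ξ))
  rw [show 2 * Real.pi * (m * ξ) = 2 * ((m : ℝ) * (Real.pi * ξ)) by ring]
  linarith

variable {ι : Type*} {B : Finset (ι → ℤ)}

theorem IsSignInvariant.sum_coord_sq_eq (hB : IsSignInvariant B) (j : ι) :
    ∑ x ∈ B, (x j : ℝ) ^ 2 = 2 * ∑ x ∈ B with 0 < x j, (x j : ℝ) ^ 2 := by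
  have hneg : ∑ x ∈ B with x j < 0, (x j : ℝ) ^ 2 = ∑ x ∈ B with 0 < x j, (x j : ℝ) ^ 2 := by
    rw [Finset.sum_filter, Finset.sum_filter, ← hB.sum_smul _ fun _ => -1]
    simp
  have hsplit : ∀ x : ι → ℤ, (x j : ℝ) ^ 2 =
      (if x j < 0 then (x j : ℝ) ^ 2 else 0) + if 0 < x j then (x j : ℝ) ^ 2 else 0 := by
    intro x
    rcases lt_trichotomy (x j) 0 with h | h | h
    · simp [h, h.le]
    · simp [h]
    · simp [h, h.le]
  rw [Finset.sum_congr rfl fun x _ => hsplit x, Finset.sum_add_distrib, ← Finset.sum_filter,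
    ← Finset.sum_filter, hneg, two_mul]

theorem sum_sq_le_of_transfer [DecidableEq ι] {i j : ι}
    (htransfer : ∀ x ∈ B, 0 < x j → x i = 0 → x - Pi.single j 1 + Pi.single i 1 ∈ B) :
    ∑ x ∈ B with 0 < x j ∧ x i = 0, (x j : ℝ) ^ 2 ≤
      ∑ y ∈ B with y i ≠ 0, 4 * (1 + (y j : ℝ) ^ 2) := by
  set τ : (ι → ℤ) → (ι → ℤ) := fun x => x - Pi.single j 1 + Pi.single i 1 with hτ
  have hinj : Function.Injective τ := fun x y h => by simpa [hτ] using h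
  calc ∑ x ∈ B with 0 < x j ∧ x i = 0, (x j : ℝ) ^ 2
      ≤ ∑ x ∈ B with 0 < x j ∧ x i = 0, 4 * (1 + (τ x j : ℝ) ^ 2) := by
        refine Finset.sum_le_sum fun x hx => ?_
        obtain ⟨-, hj, hi⟩ := Finset.mem_filter.1 hx
        have hij : j ≠ i := by rintro rfl; omega
        have hτj : τ x j = x j - 1 := by simp [hτ, hij]
        rw [hτj]
        push_cast
        nlinarith [sq_nonneg ((x j : ℝ) - 4 / 3)]
    _ = ∑ y ∈ (B.filter fun x => 0 < x j ∧ x i = 0).map ⟨τ, hinj⟩, 4 * (1 + (y j : ℝ) ^ 2) := by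
        rw [Finset.sum_map]; rfl
    _ ≤ _ := by
        refine Finset.sum_le_sum_of_subset_of_nonneg (fun y hy => ?_) fun y _ _ => by positivity
        obtain ⟨x, hx, rfl⟩ := Finset.mem_map.1 hy
        obtain ⟨hxB, hj, hi⟩ := Finset.mem_filter.1 hx
        have hij : i ≠ j := by rintro rfl; omega
        exact Finset.mem_filter.2 ⟨htransfer x hxB hj hi, by simp [hτ, hi, hij]⟩

variable [Fintype ι] {L : ℝ}

theorem card_filter_ne_zero_le {x : ι → ℤ} (hx : ∑ i, |(x i : ℝ)| ≤ L) :
    ((Finset.univ.filter fun i => x i ≠ 0).card : ℝ) ≤ L := by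
  refine le_trans ?_ hx
  rw [Finset.card_filter, Nat.cast_sum]
  refine Finset.sum_le_sum fun i _ => ?_
  split_ifs with h
  · exact_mod_cast Int.one_le_abs h
  · simp

theorem card_sub_le_card_filter_eq_zero {x : ι → ℤ} (hx : ∑ i, |(x i : ℝ)| ≤ L) :
    Fintype.card ι - L ≤ ((Finset.univ.filter fun i => x i = 0).card : ℝ) := by
  have hcompl : ((Finset.univ.filter fun i => x i = 0).card : ℝ) +
      (Finset.univ.filter fun i => x i ≠ 0).card = Fintype.card ι := by
    exact_mod_cast Finset.card_filter_add_card_filter_not _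
  linarith [card_filter_ne_zero_le hx]

variable [DecidableEq ι]

/-- Double counting the unit transfers from the coordinate `j` to a vanishing coordinate: there are
at least `card ι - L` targets, while each point of `B` arises from at most `L` of them. -/
theorem sum_pos_coord_sq_le {j : ι}
    (htransfer : ∀ x ∈ B, ∀ i, 0 < x j → x i = 0 → x - Pi.single j 1 + Pi.single i 1 ∈ B)
    (hL : ∀ x ∈ B, ∑ i, |(x i : ℝ)| ≤ L) :
    (Fintype.card ι - L) * ∑ x ∈ B with 0 < x j, (x j : ℝ) ^ 2 ≤
      4 * L * ∑ x ∈ B, (1 + (x j : ℝ) ^ 2) := by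
  calc (Fintype.card ι - L) * ∑ x ∈ B with 0 < x j, (x j : ℝ) ^ 2
      ≤ ∑ x ∈ B with 0 < x j, ∑ i with x i = 0, (x j : ℝ) ^ 2 := by
        rw [Finset.mul_sum]
        refine Finset.sum_le_sum fun x hx => ?_
        rw [Finset.sum_const, nsmul_eq_mul]
        exact mul_le_mul_of_nonneg_right
          (card_sub_le_card_filter_eq_zero (hL x (Finset.mem_filter.1 hx).1)) (sq_nonneg _)
    _ = ∑ i, ∑ x ∈ B with 0 < x j ∧ x i = 0, (x j : ℝ) ^ 2 :=
        Finset.sum_comm' fun x i => by simp only [Finset.mem_filter, Finset.mem_univ]; tauto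
    _ ≤ ∑ i, ∑ y ∈ B with y i ≠ 0, 4 * (1 + (y j : ℝ) ^ 2) :=
        Finset.sum_le_sum fun i _ => sum_sq_le_of_transfer fun x hx => htransfer x hx i
    _ = ∑ y ∈ B, ∑ i with y i ≠ 0, 4 * (1 + (y j : ℝ) ^ 2) :=
        Finset.sum_comm' fun i y => by simp only [Finset.mem_filter, Finset.mem_univ]; tauto
    _ ≤ ∑ y ∈ B, L * (4 * (1 + (y j : ℝ) ^ 2)) := by
        refine Finset.sum_le_sum fun y hy => ?_
        rw [Finset.sum_const, nsmul_eq_mul]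
        exact mul_le_mul_of_nonneg_right (card_filter_ne_zero_le (hL y hy)) (by positivity)
    _ = _ := by rw [← Finset.mul_sum, ← Finset.mul_sum]; ring

theorem IsSignInvariant.card_mul_sum_coord_sq_le (hB : IsSignInvariant B)
    (htransfer : ∀ x ∈ B, ∀ i j, 0 < x j → x i = 0 → x - Pi.single j 1 + Pi.single i 1 ∈ B)
    (hL : ∀ x ∈ B, ∑ i, |(x i : ℝ)| ≤ L) (hLι : 12 * L ≤ Fintype.card ι) (j : ι) :
    Fintype.card ι * ∑ x ∈ B, (x j : ℝ) ^ 2 ≤ 32 * L * B.card := by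
  have hpos := sum_pos_coord_sq_le (fun x hx i => htransfer x hx i j) hL
  have hS := hB.sum_coord_sq_eq j
  have hS₀ : 0 ≤ ∑ x ∈ B, (x j : ℝ) ^ 2 := Finset.sum_nonneg fun x _ => sq_nonneg _
  rw [Finset.sum_add_distrib, Finset.sum_const, nsmul_eq_mul, mul_one] at hpos
  nlinarith

theorem norm_sum_mul_cosProd_sub_le [Nonempty ι] (hB : IsSignInvariant B)
    (htransfer : ∀ x ∈ B, ∀ i j, 0 < x j → x i = 0 → x - Pi.single j 1 + Pi.single i 1 ∈ B)
    (hL : ∀ x ∈ B, ∑ i, |(x i : ℝ)| ≤ L) (hLι : 12 * L ≤ Fintype.card ι)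
    {s : (ι → ℤ) → ℂ} (hs : ∀ x, ‖s x‖ ≤ 1) (ξ : ι → ℝ) :
    ‖∑ x ∈ B, s x * (cosProd ξ x : ℂ) - ∑ x ∈ B, s x‖ ≤
      B.card * (64 * (L / Fintype.card ι * ∑ i, Real.sin (Real.pi * ξ i) ^ 2)) := by
  have hcard : (0 : ℝ) < Fintype.card ι := by exact_mod_cast Fintype.card_pos
  have hterm : ∀ x, ‖s x * (cosProd ξ x : ℂ) - s x‖ ≤
      ∑ i, 2 * ((x i : ℝ) ^ 2 * Real.sin (Real.pi * ξ i) ^ 2) := by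
    intro x
    calc ‖s x * (cosProd ξ x : ℂ) - s x‖ = ‖s x‖ * |1 - cosProd ξ x| := by
          rw [← mul_sub_one, norm_mul, norm_sub_rev, ← Complex.ofReal_one, ← Complex.ofReal_sub,
            Complex.norm_real, Real.norm_eq_abs]
      _ ≤ |1 - cosProd ξ x| := mul_le_of_le_one_left (abs_nonneg _) (hs x)
      _ ≤ ∑ i, (1 - Real.cos (2 * Real.pi * (x i * ξ i))) :=
          abs_one_sub_prod_le _ fun i => Real.abs_cos_le_one _
      _ ≤ _ := Finset.sum_le_sum fun i _ => one_sub_cos_le _ _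
  calc ‖∑ x ∈ B, s x * (cosProd ξ x : ℂ) - ∑ x ∈ B, s x‖
      ≤ ∑ x ∈ B, ∑ i, 2 * ((x i : ℝ) ^ 2 * Real.sin (Real.pi * ξ i) ^ 2) := by
        rw [← Finset.sum_sub_distrib]
        exact (norm_sum_le _ _).trans (Finset.sum_le_sum fun x _ => hterm x)
    _ = ∑ i, 2 * Real.sin (Real.pi * ξ i) ^ 2 * ∑ x ∈ B, (x i : ℝ) ^ 2 := by
        rw [Finset.sum_comm]
        refine Finset.sum_congr rfl fun i _ => ?_
        rw [Finset.mul_sum]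
        exact Finset.sum_congr rfl fun x _ => by ring
    _ ≤ ∑ i, 2 * Real.sin (Real.pi * ξ i) ^ 2 * (32 * L * B.card / Fintype.card ι) := by
        gcongr with i
        rw [le_div_iff₀' hcard]
        exact hB.card_mul_sum_coord_sq_le htransfer hL hLι i
    _ = _ := by
        rw [← Finset.sum_mul, ← Finset.mul_sum]
        ring

end LowFrequency

section Tail

variable {ι : Type*} [Fintype ι] {B : Finset (ι → ℤ)} {L : ℝ}

/-- The set of coordinates of modulus one of a lattice point. -/
def ones (x : ι → ℤ) : Finset ι := {i | |x i| = 1}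

theorem mem_ones {x : ι → ℤ} {i : ι} : i ∈ ones x ↔ |x i| = 1 := by simp [ones]

/-- The exponential weight for the Rankin trick: a coordinate of modulus one is penalised twice, so
that the points with few such coordinates carry a comparatively large weight. -/
noncomputable def rankinWeight (t : ℝ) (m : ℤ) : ℝ :=
  Real.exp (-(t * (|(m : ℝ)| + if |m| = 1 then 1 else 0)))

theorem rankinWeight_nonneg (t : ℝ) (m : ℤ) : 0 ≤ rankinWeight t m := (Real.exp_pos _).le

theorem rankinWeight_zero (t : ℝ) : rankinWeight t 0 = 1 := by simp [rankinWeight]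

theorem rankinWeight_one (t : ℝ) : rankinWeight t 1 = Real.exp (-t) ^ 2 := by
  rw [rankinWeight, ← Real.exp_nat_mul]
  norm_num
  ring

theorem rankinWeight_natCast_add_two (t : ℝ) (m : ℕ) :
    rankinWeight t (m + 2 : ℕ) = Real.exp (-t) ^ (m + 2) := by
  have hm : |((m + 2 : ℕ) : ℤ)| ≠ 1 := by rw [Nat.abs_cast]; omega
  rw [rankinWeight, if_neg hm, Int.cast_natCast, Nat.abs_cast, ← Real.exp_nat_mul]
  ring_nf

theorem sum_range_rankinWeight_le {t : ℝ} (ht : 6 ≤ t) (n : ℕ) :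
    ∑ m ∈ Finset.range (n + 2), rankinWeight t m ≤ 1 + 9 / 4 * Real.exp (-t) ^ 2 := by
  set s := Real.exp (-t) with hs
  have hs₀ : 0 ≤ s := (Real.exp_pos _).le
  have hs₁ : s ≤ 1 / 7 := by
    rw [hs, Real.exp_neg, ← one_div]
    exact one_div_le_one_div_of_le (by norm_num) (by linarith [Real.add_one_le_exp t])
  have hgeom : ∑ m ∈ Finset.range n, s ^ m ≤ 5 / 4 := by
    have h := geom_sum_Ico_le_of_lt_one (m := 0) (n := n) hs₀ (by linarith)
    rw [Nat.Ico_zero_eq_range, pow_zero] at h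
    refine h.trans ?_
    rw [div_le_iff₀ (by linarith)]
    linarith
  have hsplit : ∑ m ∈ Finset.range (n + 2), rankinWeight t m =
      s ^ 2 * ∑ m ∈ Finset.range n, s ^ m + s ^ 2 + 1 := by
    rw [Finset.sum_range_succ', Finset.sum_range_succ', Nat.cast_zero, rankinWeight_zero,
      zero_add, Nat.cast_one, rankinWeight_one, Finset.mul_sum]
    simp only [add_assoc, one_add_one_eq_two, rankinWeight_natCast_add_two, pow_add, mul_comm, hs]
  rw [hsplit]
  nlinarith [sq_nonneg s]

theorem sum_Icc_rankinWeight_le {t : ℝ} (ht : 6 ≤ t) (n : ℕ) :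
    ∑ m ∈ Finset.Icc (-((n + 1 : ℕ) : ℤ)) (n + 1 : ℕ), rankinWeight t m ≤
      1 + 9 / 2 * Real.exp (-t) ^ 2 := by
  have heven : (rankinWeight t).Even := fun m => by simp [rankinWeight]
  rw [Finset.sum_Icc_of_even_eq_range heven, rankinWeight_zero, nsmul_eq_mul, Nat.cast_ofNat]
  linarith [sum_range_rankinWeight_le ht n]

theorem exp_neg_le_prod_rankinWeight {t K : ℝ} (ht : 0 ≤ t) {x : ι → ℤ}
    (hx : ∑ i, |(x i : ℝ)| ≤ L) (hK : ((ones x).card : ℝ) ≤ K) :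
    Real.exp (-(t * (L + K))) ≤ ∏ i, rankinWeight t (x i) := by
  simp only [rankinWeight]
  rw [← Real.exp_sum, Real.exp_le_exp, Finset.sum_neg_distrib, neg_le_neg_iff, ← Finset.mul_sum,
    Finset.sum_add_distrib]
  have hones : ∑ i, (if |x i| = 1 then (1 : ℝ) else 0) = (ones x).card := by simp [ones]
  rw [hones]
  gcongr

theorem card_filter_ones_mul_exp_le (hL : ∀ x ∈ B, ∑ i, |(x i : ℝ)| ≤ L) {t : ℝ} (ht : 6 ≤ t)
    (K : ℝ) :
    ((B.filter fun x => ((ones x).card : ℝ) ≤ K).card : ℝ) * Real.exp (-(t * (L + K))) ≤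
      Real.exp (9 / 2 * (Fintype.card ι * Real.exp (-t) ^ 2)) := by
  classical
  set box : Finset ℤ := Finset.Icc (-((⌊L⌋₊ + 1 : ℕ) : ℤ)) (⌊L⌋₊ + 1 : ℕ)
  have hmem : ∀ x ∈ B, x ∈ Fintype.piFinset fun _ : ι => box := by
    refine fun x hx => Fintype.mem_piFinset.2 fun i => Finset.mem_Icc.2 (abs_le.1 ?_)
    have hxi : |(x i : ℝ)| ≤ ((⌊L⌋₊ + 1 : ℕ) : ℝ) := by
      push_cast
      exact ((Finset.single_le_sum (fun j _ => abs_nonneg (x j : ℝ)) (Finset.mem_univ i)).trans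
        (hL x hx)).trans (Nat.lt_floor_add_one L).le
    exact_mod_cast hxi
  calc _ = ∑ x ∈ B with ((ones x).card : ℝ) ≤ K, Real.exp (-(t * (L + K))) := by
        rw [Finset.sum_const, nsmul_eq_mul]
    _ ≤ ∑ x ∈ B with ((ones x).card : ℝ) ≤ K, ∏ i, rankinWeight t (x i) := by
        refine Finset.sum_le_sum fun x hx => ?_
        obtain ⟨hxB, hxK⟩ := Finset.mem_filter.1 hx
        exact exp_neg_le_prod_rankinWeight (by linarith) (hL x hxB) hxK
    _ ≤ ∑ x ∈ Fintype.piFinset fun _ : ι => box, ∏ i, rankinWeight t (x i) :=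
        Finset.sum_le_sum_of_subset_of_nonneg (fun x hx => hmem x (Finset.mem_filter.1 hx).1)
          fun x _ _ => Finset.prod_nonneg fun i _ => rankinWeight_nonneg _ _
    _ = (∑ m ∈ box, rankinWeight t m) ^ Fintype.card ι := by
        rw [← Finset.prod_univ_sum (fun _ => box) fun _ m => rankinWeight t m, Finset.prod_const,
          Finset.card_univ]
    _ ≤ Real.exp (9 / 2 * Real.exp (-t) ^ 2) ^ Fintype.card ι := by
        refine pow_le_pow_left₀ (Finset.sum_nonneg fun m _ => rankinWeight_nonneg _ _) ?_ _
        linarith [sum_Icc_rankinWeight_le ht ⌊L⌋₊,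
          Real.add_one_le_exp (9 / 2 * Real.exp (-t) ^ 2)]
    _ = _ := by rw [← Real.exp_nat_mul]; ring_nf

theorem div_pow_le_choose {n k : ℕ} (hkn : k ≤ n) : ((n : ℝ) / k) ^ k ≤ n.choose k := by
  induction k generalizing n with
  | zero => simp
  | succ k ih =>
    obtain ⟨n, rfl⟩ : ∃ m, n = m + 1 := ⟨n - 1, by omega⟩
    have hkn' : k ≤ n := by omega
    have hratio : ((n + 1 : ℝ) / (k + 1)) ^ k ≤ ((n : ℝ) / k) ^ k := by
      rcases k.eq_zero_or_pos with rfl | hk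
      · simp
      · have : (k : ℝ) ≤ n := by exact_mod_cast hkn'
        refine pow_le_pow_left₀ (by positivity) ?_ k
        rw [div_le_div_iff₀ (by positivity) (by positivity)]
        linarith
    calc (((n + 1 : ℕ) : ℝ) / (k + 1 : ℕ)) ^ (k + 1)
        = ((n + 1 : ℝ) / (k + 1)) ^ k * ((n + 1) / (k + 1)) := by push_cast; rw [pow_succ]
      _ ≤ n.choose k * ((n + 1) / (k + 1)) := by gcongr; exact hratio.trans (ih hkn')
      _ = (n + 1).choose (k + 1) := by
        rw [← mul_div_assoc, div_eq_iff (by positivity), mul_comm]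
        exact_mod_cast Nat.add_one_mul_choose_eq n k

theorem choose_floor_le_card
    (hindicator : ∀ I : Finset ι, (I.card : ℝ) ≤ L → Set.indicator I 1 ∈ B) (hL : 0 ≤ L) :
    (Fintype.card ι).choose ⌊L⌋₊ ≤ B.card := by
  rw [← Finset.card_univ, ← Finset.card_powersetCard]
  refine Finset.card_le_card_of_injOn (fun I => Set.indicator I 1) (fun I hI => ?_)
    fun I _ J _ hIJ => Finset.coe_injective (Set.indicator_one_inj ℤ hIJ)
  refine hindicator I ?_
  rw [(Finset.mem_powersetCard.1 hI).2]
  exact Nat.floor_le hL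

theorem exp_log_mul_floor_le_card
    (hindicator : ∀ I : Finset ι, (I.card : ℝ) ≤ L → Set.indicator I 1 ∈ B) (hL : 1 ≤ L)
    (hLι : L ≤ Fintype.card ι) :
    Real.exp (Real.log (Fintype.card ι / L) * ⌊L⌋₊) ≤ B.card := by
  have hfloor : (⌊L⌋₊ : ℝ) ≤ L := Nat.floor_le (by linarith)
  have hfloor₀ : (0 : ℝ) < ⌊L⌋₊ := by exact_mod_cast Nat.floor_pos.2 hL
  have hfloor_le : ⌊L⌋₊ ≤ Fintype.card ι := by exact_mod_cast hfloor.trans hLι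
  calc Real.exp (Real.log (Fintype.card ι / L) * ⌊L⌋₊) = (Fintype.card ι / L) ^ ⌊L⌋₊ := by
        rw [mul_comm, Real.exp_nat_mul, Real.exp_log (div_pos (by linarith) (by linarith))]
    _ ≤ (Fintype.card ι / ⌊L⌋₊) ^ ⌊L⌋₊ := by gcongr
    _ ≤ (Fintype.card ι).choose ⌊L⌋₊ := div_pow_le_choose hfloor_le
    _ ≤ B.card := by exact_mod_cast choose_floor_le_card hindicator (by linarith)

theorem card_filter_ones_le (hL : ∀ x ∈ B, ∑ i, |(x i : ℝ)| ≤ L)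
    (hindicator : ∀ I : Finset ι, (I.card : ℝ) ≤ L → Set.indicator I 1 ∈ B) (hL₆₄ : 64 ≤ L)
    (hLι : Real.exp 12 * L ≤ Fintype.card ι) :
    ((B.filter fun x => ((ones x).card : ℝ) ≤ L / 80).card : ℝ) ≤ 1 / L * B.card := by
  have hL₀ : 0 < L := by linarith
  have hι₀ : (0 : ℝ) < Fintype.card ι := (mul_pos (Real.exp_pos _) hL₀).trans_le hLι
  set l := Real.log (Fintype.card ι / L) with hl
  have hl₁₂ : 12 ≤ l := (Real.le_log_iff_exp_le (by positivity)).2 ((le_div_iff₀ hL₀).2 hLι)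
  have hcard := exp_log_mul_floor_le_card hindicator (by linarith)
    ((le_mul_of_one_le_left hL₀.le (Real.one_le_exp (by norm_num))).trans hLι)
  -- The Rankin trick with `t = l / 2`, for which `card ι * exp (-2 * t) = L`.
  have hrankin := card_filter_ones_mul_exp_le hL (t := l / 2) (by linarith) (L / 80)
  have hbox : Fintype.card ι * Real.exp (-(l / 2)) ^ 2 = L := by
    rw [← Real.exp_nat_mul, Nat.cast_ofNat, mul_neg, mul_div_cancel₀ _ two_ne_zero, Real.exp_neg,
      hl, Real.exp_log (by positivity), inv_div, mul_div_cancel₀ _ hι₀.ne']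
  rw [hbox, ← le_div_iff₀ (Real.exp_pos _), ← Real.exp_sub] at hrankin
  have hexponent : 9 / 2 * L - -(l / 2 * (L + L / 80)) ≤ -L + l * ⌊L⌋₊ := by
    have hfloor : 63 / 64 * L ≤ ⌊L⌋₊ := by linarith [Nat.lt_floor_add_one L]
    nlinarith [mul_le_mul_of_nonneg_left hfloor (by linarith : 0 ≤ l)]
  have hexp : Real.exp (-L) ≤ 1 / L := by
    rw [Real.exp_neg, ← one_div]
    exact one_div_le_one_div_of_le hL₀ (by linarith [Real.add_one_le_exp L])
  calc _ ≤ Real.exp (-L + l * ⌊L⌋₊) := hrankin.trans (Real.exp_le_exp.2 hexponent)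
    _ = Real.exp (-L) * Real.exp (l * ⌊L⌋₊) := Real.exp_add _ _
    _ ≤ 1 / L * B.card := by gcongr

end Tail

section Levels

variable {ι : Type*}

/-- The set of coordinates of modulus at most one of a lattice point. -/
def small [Fintype ι] (x : ι → ℤ) : Finset ι := {i | |x i| ≤ 1}

theorem mem_small [Fintype ι] {x : ι → ℤ} {i : ι} : i ∈ small x ↔ |x i| ≤ 1 := by simp [small]

theorem ones_subset_small [Fintype ι] (x : ι → ℤ) : ones x ⊆ small x :=
  fun _ hi => mem_small.2 (mem_ones.1 hi).le

theorem exists_perm_mem_iff {α : Type*} [Finite α] {s t : Finset α} (h : s.card = t.card) :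
    ∃ σ : Equiv.Perm α, ∀ a, σ a ∈ t ↔ a ∈ s := by
  obtain ⟨σ, rfl⟩ := Equiv.Perm.exists_map_finset_eq s t h
  exact ⟨σ, fun a => by simp⟩

theorem exists_perm_fix_compl {U I I' : Finset ι} (hI : I ⊆ U) (hI' : I' ⊆ U)
    (hcard : I.card = I'.card) :
    ∃ σ : Equiv.Perm ι, (∀ a ∉ U, σ a = a) ∧ (∀ a, σ a ∈ U ↔ a ∈ U) ∧ ∀ a, σ a ∈ I' ↔ a ∈ I := by
  classical
  have hcard' : (I.subtype (· ∈ U)).card = (I'.subtype (· ∈ U)).card := by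
    rw [Finset.card_subtype, Finset.card_subtype, Finset.filter_true_of_mem hI,
      Finset.filter_true_of_mem hI', hcard]
  obtain ⟨τ, hτ⟩ := exists_perm_mem_iff hcard'
  have hfix : ∀ a ∉ U, Equiv.Perm.ofSubtype τ a = a := fun a ha =>
    Equiv.Perm.ofSubtype_apply_of_not_mem τ ha
  refine ⟨Equiv.Perm.ofSubtype τ, hfix, Equiv.Perm.ofSubtype_apply_mem_iff_mem τ, fun a => ?_⟩
  by_cases ha : a ∈ U
  · rw [Equiv.Perm.ofSubtype_apply_of_mem τ ha]
    simpa only [Finset.mem_subtype] using hτ ⟨a, ha⟩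
  · rw [hfix a ha]
    exact iff_of_false (fun h => ha (hI' h)) fun h => ha (hI h)

theorem exists_perm_mem_iff_of_subset [Finite ι] {U U' I I' : Finset ι} (hI : I ⊆ U)
    (hI' : I' ⊆ U') (hU : U.card = U'.card) (hcard : I.card = I'.card) :
    ∃ σ : Equiv.Perm ι, (∀ a, σ a ∈ U' ↔ a ∈ U) ∧ ∀ a, σ a ∈ I' ↔ a ∈ I := by
  obtain ⟨σ, hσ⟩ := exists_perm_mem_iff hU
  have hmap : I.map σ.toEmbedding ⊆ U' := by
    intro b hb
    obtain ⟨a, ha, rfl⟩ := Finset.mem_map.1 hb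
    exact (hσ a).2 (hI ha)
  obtain ⟨τ, -, hτU, hτI⟩ := exists_perm_fix_compl hmap hI' ((Finset.card_map _).trans hcard)
  exact ⟨τ * σ, fun a => (hτU _).trans (hσ a), fun a => (hτI _).trans (by simp)⟩

variable [Fintype ι] [DecidableEq ι] {B : Finset (ι → ℤ)}

/-- The points of `B` whose small coordinates are those in `U` and whose coordinates of modulus one
are those in `I`. -/
def fiber (B : Finset (ι → ℤ)) (U I : Finset ι) : Finset (ι → ℤ) :=
  B.filter fun x => small x = U ∧ ones x = I

/-- The points of `B` with `n` small coordinates, `k` of which have modulus one. -/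
def level (B : Finset (ι → ℤ)) (n k : ℕ) : Finset (ι → ℤ) :=
  B.filter fun x => (small x).card = n ∧ (ones x).card = k

theorem sum_level_eq {M : Type*} [AddCommMonoid M] (B : Finset (ι → ℤ)) (n k : ℕ)
    (g : (ι → ℤ) → M) :
    ∑ x ∈ level B n k, g x =
      ∑ U ∈ Finset.univ.powersetCard n, ∑ I ∈ U.powersetCard k, ∑ x ∈ fiber B U I, g x := by
  have hsmall : ∀ x ∈ level B n k, small x ∈ Finset.univ.powersetCard n := fun x hx =>
    Finset.mem_powersetCard.2 ⟨Finset.subset_univ _, (Finset.mem_filter.1 hx).2.1⟩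
  rw [← Finset.sum_fiberwise_of_maps_to hsmall]
  refine Finset.sum_congr rfl fun U hU => ?_
  have hones : ∀ x ∈ (level B n k).filter (small · = U), ones x ∈ U.powersetCard k := by
    intro x hx
    obtain ⟨hxB, rfl⟩ := Finset.mem_filter.1 hx
    exact Finset.mem_powersetCard.2 ⟨ones_subset_small x, (Finset.mem_filter.1 hxB).2.2⟩
  rw [← Finset.sum_fiberwise_of_maps_to hones]
  refine Finset.sum_congr rfl fun I hI => Finset.sum_congr ?_ fun _ _ => rfl
  have hUn := (Finset.mem_powersetCard.1 hU).2
  have hIk := (Finset.mem_powersetCard.1 hI).2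
  ext x
  simp only [level, fiber, Finset.mem_filter]
  refine ⟨fun h => ⟨h.1.1.1, h.1.2, h.2⟩, ?_⟩
  rintro ⟨hx, rfl, rfl⟩
  exact ⟨⟨⟨hx, hUn, hIk⟩, rfl⟩, rfl⟩

theorem comp_perm_mem_fiber_iff (hB : IsPermInvariant B) {U U' I I' : Finset ι}
    {σ : Equiv.Perm ι} (hσU : ∀ a, σ a ∈ U' ↔ a ∈ U) (hσI : ∀ a, σ a ∈ I' ↔ a ∈ I) (x : ι → ℤ) :
    x ∈ fiber B U' I' ↔ x ∘ σ ∈ fiber B U I := by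
  have hsmall : small (x ∘ σ) = U ↔ small x = U' := by
    simp only [Finset.ext_iff, mem_small, Function.comp_apply, ← hσU]
    exact σ.forall_congr_right (q := fun a => |x a| ≤ 1 ↔ a ∈ U')
  have hones : ones (x ∘ σ) = I ↔ ones x = I' := by
    simp only [Finset.ext_iff, mem_ones, Function.comp_apply, ← hσI]
    exact σ.forall_congr_right (q := fun a => |x a| = 1 ↔ a ∈ I')
  rw [fiber, fiber, Finset.mem_filter, Finset.mem_filter, hB.comp_mem_iff, hsmall, hones]

theorem sum_fiber_comp_perm (hB : IsPermInvariant B) {U U' I I' : Finset ι} {σ : Equiv.Perm ι}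
    (hσU : ∀ a, σ a ∈ U' ↔ a ∈ U) (hσI : ∀ a, σ a ∈ I' ↔ a ∈ I) {M : Type*} [AddCommMonoid M]
    (g : (ι → ℤ) → M) : ∑ x ∈ fiber B U' I', g (x ∘ σ) = ∑ x ∈ fiber B U I, g x :=
  Finset.sum_equiv (σ.symm.arrowCongr (Equiv.refl ℤ))
    (fun x => comp_perm_mem_fiber_iff hB hσU hσI x) fun _ _ => rfl

theorem card_fiber_eq (hB : IsPermInvariant B) {U U' I I' : Finset ι} (hI : I ⊆ U)
    (hI' : I' ⊆ U') (hU : U.card = U'.card) (hcard : I.card = I'.card) :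
    (fiber B U I).card = (fiber B U' I').card := by
  obtain ⟨σ, hσU, hσI⟩ := exists_perm_mem_iff_of_subset hI hI' hU hcard
  rw [Finset.card_eq_sum_ones, Finset.card_eq_sum_ones]
  exact (sum_fiber_comp_perm hB hσU hσI fun _ => 1).symm

theorem card_level_eq (hB : IsPermInvariant B) {U I : Finset ι} (hI : I ⊆ U) :
    (level B U.card I.card).card =
      (fiber B U I).card * ((Fintype.card ι).choose U.card * U.card.choose I.card) := by
  have hfiber : ∀ U' ∈ Finset.univ.powersetCard U.card, ∀ I' ∈ U'.powersetCard I.card,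
      ∑ _x ∈ fiber B U' I', 1 = (fiber B U I).card := by
    intro U' hU' I' hI'
    rw [Finset.mem_powersetCard] at hU' hI'
    rw [← Finset.card_eq_sum_ones]
    exact card_fiber_eq hB hI'.1 hI hU'.2 hI'.2
  have hinner : ∀ U' ∈ Finset.univ.powersetCard U.card,
      ∑ I' ∈ U'.powersetCard I.card, ∑ _x ∈ fiber B U' I', 1 =
        U.card.choose I.card * (fiber B U I).card := by
    intro U' hU'
    rw [Finset.sum_congr rfl (hfiber U' hU'), Finset.sum_const, Finset.card_powersetCard,
      (Finset.mem_powersetCard.1 hU').2, smul_eq_mul]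
  rw [Finset.card_eq_sum_ones, sum_level_eq, Finset.sum_congr rfl hinner, Finset.sum_const,
    Finset.card_powersetCard, Finset.card_univ, smul_eq_mul]
  ring

theorem cosProd_eq_prod_ones_mul (ξ : ι → ℝ) (x : ι → ℤ) :
    cosProd ξ x = (∏ i ∈ ones x, (1 - 2 * Real.sin (Real.pi * ξ i) ^ 2)) *
      ∏ i ∈ (small x)ᶜ, Real.cos (2 * Real.pi * (x i * ξ i)) := by
  rw [cosProd, ← Finset.prod_mul_prod_compl (small x), ← Finset.prod_subset (ones_subset_small x)]
  · congr 1
    refine Finset.prod_congr rfl fun i hi => ?_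
    have hcos : Real.cos (2 * Real.pi * ξ i) = 1 - 2 * Real.sin (Real.pi * ξ i) ^ 2 := by
      rw [mul_assoc, Real.cos_two_mul, Real.cos_sq']; ring
    rcases (abs_eq zero_le_one).1 (mem_ones.1 hi) with h | h <;> simp [h, hcos]
  · intro i hi hi'
    have hxi : x i = 0 := by
      rw [mem_small] at hi
      rw [mem_ones] at hi'
      exact abs_eq_zero.1 (by have := abs_nonneg (x i); omega)
    simp [hxi]

theorem sum_fiber_cosProd (B : Finset (ι → ℤ)) (U I : Finset ι) (ξ : ι → ℝ) :
    ∑ x ∈ fiber B U I, cosProd ξ x = (∏ i ∈ I, (1 - 2 * Real.sin (Real.pi * ξ i) ^ 2)) *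
      ∑ x ∈ fiber B U I, ∏ i ∈ Uᶜ, Real.cos (2 * Real.pi * (x i * ξ i)) := by
  rw [Finset.mul_sum]
  refine Finset.sum_congr rfl fun x hx => ?_
  obtain ⟨-, rfl, rfl⟩ := Finset.mem_filter.1 hx
  exact cosProd_eq_prod_ones_mul ξ x

theorem sum_fiber_prod_compl_eq (hB : IsPermInvariant B) {U I I' : Finset ι} (hI : I ⊆ U)
    (hI' : I' ⊆ U) (hcard : I.card = I'.card) {R : Type*} [CommSemiring R] (f : ℤ → ι → R) :
    ∑ x ∈ fiber B U I, ∏ i ∈ Uᶜ, f (x i) i = ∑ x ∈ fiber B U I', ∏ i ∈ Uᶜ, f (x i) i := by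
  obtain ⟨σ, hfix, hσU, hσI⟩ := exists_perm_fix_compl hI hI' hcard
  rw [← sum_fiber_comp_perm hB hσU hσI]
  refine Finset.sum_congr rfl fun x _ => Finset.prod_congr rfl fun i hi => ?_
  rw [Function.comp_apply, hfix i (Finset.mem_compl.1 hi)]

theorem abs_sum_powersetCard_fiber_cosProd_le (hB : IsPermInvariant B) {U I : Finset ι}
    (hI : I ⊆ U) (ξ : ι → ℝ) :
    |∑ I' ∈ U.powersetCard I.card, ∑ x ∈ fiber B U I', cosProd ξ x| ≤ (fiber B U I).card *
      |∑ I' ∈ U.powersetCard I.card, ∏ i ∈ I', (1 - 2 * Real.sin (Real.pi * ξ i) ^ 2)| := by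
  have hfactor : ∑ I' ∈ U.powersetCard I.card, ∑ x ∈ fiber B U I', cosProd ξ x =
      (∑ x ∈ fiber B U I, ∏ i ∈ Uᶜ, Real.cos (2 * Real.pi * (x i * ξ i))) *
        ∑ I' ∈ U.powersetCard I.card, ∏ i ∈ I', (1 - 2 * Real.sin (Real.pi * ξ i) ^ 2) := by
    rw [Finset.mul_sum]
    refine Finset.sum_congr rfl fun I' hI' => ?_
    obtain ⟨hI'U, hI'card⟩ := Finset.mem_powersetCard.1 hI'
    rw [sum_fiber_cosProd, mul_comm, sum_fiber_prod_compl_eq hB hI'U hI hI'card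
      fun m i => Real.cos (2 * Real.pi * (m * ξ i))]
  rw [hfactor, abs_mul]
  gcongr
  refine (Finset.abs_sum_le_sum_abs _ _).trans ?_
  rw [← nsmul_one]
  refine Finset.sum_le_card_nsmul _ _ _ fun x _ => ?_
  rw [Finset.abs_prod]
  exact Finset.prod_le_one (fun i _ => abs_nonneg _) fun i _ => Real.abs_cos_le_one _

omit [DecidableEq ι] in
theorem abs_sum_level_cosProd_le {c : ℝ} (hc : IsKrawtchoukConstant c) (hB : IsPermInvariant B)
    {n k : ℕ} (hn : Fintype.card ι ≤ 2 * n) (hnι : n ≤ Fintype.card ι) (hk : 2 * k ≤ n)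
    (ξ : ι → ℝ) :
    |∑ x ∈ level B n k, cosProd ξ x| ≤ (level B n k).card *
      (Real.exp (-(c * k / n / 4 * ∑ i, Real.sin (Real.pi * ξ i) ^ 2)) +
        Real.exp (-(c * k / n / 4 * ∑ i, (1 - Real.sin (Real.pi * ξ i) ^ 2)))) := by
  classical
  obtain ⟨U, -, rfl⟩ := Finset.exists_subset_card_eq (s := (Finset.univ : Finset ι)) hnι
  obtain ⟨I, hI, rfl⟩ := Finset.exists_subset_card_eq (s := U) (n := k) (by omega)
  have hU : ∀ U' ∈ Finset.univ.powersetCard U.card,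
      |∑ I' ∈ U'.powersetCard I.card, ∑ x ∈ fiber B U' I', cosProd ξ x| ≤ (fiber B U I).card *
        |∑ I' ∈ U'.powersetCard I.card, ∏ i ∈ I', (1 - 2 * Real.sin (Real.pi * ξ i) ^ 2)| := by
    intro U' hU'
    have hcardU' := (Finset.mem_powersetCard.1 hU').2
    obtain ⟨I', hI', hcardI'⟩ := Finset.exists_subset_card_eq (s := U') (n := I.card) (by omega)
    rw [← hcardI', card_fiber_eq hB hI hI' hcardU'.symm hcardI'.symm]
    exact abs_sum_powersetCard_fiber_cosProd_le hB hI' ξ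
  have hkrawtchouk := hc.sum_abs_sum_powersetCard_le Finset.univ hn hk
    (p := fun i => Real.sin (Real.pi * ξ i) ^ 2) (fun i => sq_nonneg _)
    fun i => Real.sin_sq_le_one _
  rw [sum_level_eq, card_level_eq hB hI]
  refine (Finset.abs_sum_le_sum_abs _ _).trans ((Finset.sum_le_sum hU).trans ?_)
  rw [← Finset.mul_sum]
  push_cast
  rw [mul_assoc]
  exact mul_le_mul_of_nonneg_left hkrawtchouk (Nat.cast_nonneg _)

end Levels

section Decay

variable {ι : Type*} [Fintype ι] {B : Finset (ι → ℤ)} {L : ℝ}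

theorem card_ones_le {x : ι → ℤ} (hx : ∑ i, |(x i : ℝ)| ≤ L) : ((ones x).card : ℝ) ≤ L := by
  refine (Nat.cast_le.2 (Finset.card_le_card fun i hi => ?_)).trans (card_filter_ne_zero_le hx)
  rw [mem_ones] at hi
  exact Finset.mem_filter.2 ⟨Finset.mem_univ i, fun h => by simp [h] at hi⟩

theorem card_sub_le_card_small {x : ι → ℤ} (hx : ∑ i, |(x i : ℝ)| ≤ L) :
    Fintype.card ι - L ≤ ((small x).card : ℝ) := by
  refine (card_sub_le_card_filter_eq_zero hx).trans (Nat.cast_le.2 (Finset.card_le_card ?_))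
  exact fun i hi => mem_small.2 (by simp [(Finset.mem_filter.1 hi).2])

theorem abs_sum_level_cosProd_le_of_mem {c : ℝ} (hc : IsKrawtchoukConstant c)
    (hB : IsPermInvariant B) (hL₀ : 0 < L) (hLι : 4 * L ≤ Fintype.card ι) {x : ι → ℤ}
    (hx : ∑ i, |(x i : ℝ)| ≤ L) (hones : L / 80 ≤ (ones x).card) (ξ : ι → ℝ) :
    |∑ y ∈ level B (small x).card (ones x).card, cosProd ξ y| ≤
      (level B (small x).card (ones x).card).card *
        (2 * Real.exp (-(c * (L / Fintype.card ι) / 320 *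
          min (∑ i, Real.sin (Real.pi * ξ i) ^ 2) (∑ i, (1 - Real.sin (Real.pi * ξ i) ^ 2))))) := by
  set n := (small x).card
  set k := (ones x).card
  set S := ∑ i, Real.sin (Real.pi * ξ i) ^ 2
  set S' := ∑ i, (1 - Real.sin (Real.pi * ξ i) ^ 2)
  have hk := card_ones_le hx
  have hnL := card_sub_le_card_small hx
  have hnι : n ≤ Fintype.card ι := Finset.card_le_univ _
  have hn : Fintype.card ι ≤ 2 * n := by
    rify
    linarith
  have hkn : 2 * k ≤ n := by
    rify
    linarith
  have hcoeff : c * (L / Fintype.card ι) / 320 ≤ c * k / n / 4 := by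
    have hquot : L / 80 / Fintype.card ι ≤ (k : ℝ) / n :=
      div_le_div₀ (Nat.cast_nonneg _) hones (by linarith) (Nat.cast_le.2 hnι)
    calc c * (L / Fintype.card ι) / 320 = c * (L / 80 / Fintype.card ι) / 4 := by ring
      _ ≤ c * (k / n) / 4 := by have := hc.1; gcongr
      _ = c * k / n / 4 := by ring
  have hmin : 0 ≤ min S S' := le_min (Finset.sum_nonneg fun i _ => sq_nonneg _)
    (Finset.sum_nonneg fun i _ => sub_nonneg.2 (Real.sin_sq_le_one _))
  have hexp : ∀ T, min S S' ≤ T → Real.exp (-(c * k / n / 4 * T)) ≤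
      Real.exp (-(c * (L / Fintype.card ι) / 320 * min S S')) := by
    intro T hT
    have := hc.1
    gcongr
  refine (abs_sum_level_cosProd_le hc hB hn hnι hkn ξ).trans ?_
  gcongr
  linarith [hexp S (min_le_left _ _), hexp S' (min_le_right _ _)]

theorem abs_sum_filter_cosProd_le {c : ℝ} (hc : IsKrawtchoukConstant c) (hB : IsPermInvariant B)
    (hL : ∀ x ∈ B, ∑ i, |(x i : ℝ)| ≤ L) (hL₀ : 0 < L) (hLι : 4 * L ≤ Fintype.card ι)
    (ξ : ι → ℝ) :
    |∑ x ∈ B with ¬((ones x).card : ℝ) ≤ L / 80, cosProd ξ x| ≤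
      (B.filter fun x => ¬((ones x).card : ℝ) ≤ L / 80).card *
        (2 * Real.exp (-(c * (L / Fintype.card ι) / 320 *
          min (∑ i, Real.sin (Real.pi * ξ i) ^ 2) (∑ i, (1 - Real.sin (Real.pi * ξ i) ^ 2))))) := by
  set G := B.filter fun x => ¬((ones x).card : ℝ) ≤ L / 80 with hG
  set cards : (ι → ℤ) → ℕ × ℕ := fun x => ((small x).card, (ones x).card) with hcards
  have hmaps : ∀ x ∈ G, cards x ∈ G.image cards := fun x hx => Finset.mem_image_of_mem _ hx
  rw [← Finset.sum_fiberwise_of_maps_to hmaps, Finset.card_eq_sum_card_fiberwise hmaps,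
    Nat.cast_sum, Finset.sum_mul]
  refine (Finset.abs_sum_le_sum_abs _ _).trans (Finset.sum_le_sum fun p hp => ?_)
  obtain ⟨x, hx, rfl⟩ := Finset.mem_image.1 hp
  obtain ⟨hxB, hxL⟩ := Finset.mem_filter.1 hx
  have hlevel : G.filter (cards · = cards x) = level B (small x).card (ones x).card := by
    ext y
    simp only [hG, hcards, level, Finset.mem_filter, Prod.mk.injEq]
    exact ⟨fun h => ⟨h.1.1, h.2⟩, fun h => ⟨⟨h.1, by rwa [h.2.2]⟩, h.2⟩⟩
  rw [hlevel]
  exact abs_sum_level_cosProd_le_of_mem hc hB hL₀ hLι (hL x hxB) (not_le.1 hxL).le ξ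

theorem abs_sum_cosProd_le {c : ℝ} (hc : IsKrawtchoukConstant c) (hB : IsPermInvariant B)
    (hL : ∀ x ∈ B, ∑ i, |(x i : ℝ)| ≤ L)
    (hindicator : ∀ I : Finset ι, (I.card : ℝ) ≤ L → Set.indicator I 1 ∈ B) (hL₆₄ : 64 ≤ L)
    (hLι : Real.exp 12 * L ≤ Fintype.card ι) (ξ : ι → ℝ) :
    |∑ x ∈ B, cosProd ξ x| ≤ B.card * (2 * Real.exp (-(c * (L / Fintype.card ι) / 320 *
      min (∑ i, Real.sin (Real.pi * ξ i) ^ 2) (∑ i, (1 - Real.sin (Real.pi * ξ i) ^ 2))))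
        + 1 / L) := by
  set E := Real.exp (-(c * (L / Fintype.card ι) / 320 *
    min (∑ i, Real.sin (Real.pi * ξ i) ^ 2) (∑ i, (1 - Real.sin (Real.pi * ξ i) ^ 2))))
  have hL₄ : 4 * L ≤ Fintype.card ι := by nlinarith [Real.add_one_le_exp (12 : ℝ)]
  have hfew : |∑ x ∈ B with ((ones x).card : ℝ) ≤ L / 80, cosProd ξ x| ≤ 1 / L * B.card := by
    refine le_trans ?_ (card_filter_ones_le hL hindicator hL₆₄ hLι)
    refine (Finset.abs_sum_le_sum_abs _ _).trans ?_
    rw [← nsmul_one]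
    exact Finset.sum_le_card_nsmul _ _ _ fun x _ => abs_cosProd_le_one ξ x
  have hmany := abs_sum_filter_cosProd_le hc hB hL (by linarith) hL₄ ξ
  have hcard : ((B.filter fun x => ¬((ones x).card : ℝ) ≤ L / 80).card : ℝ) ≤ B.card :=
    Nat.cast_le.2 (Finset.card_filter_le _ _)
  rw [← Finset.sum_filter_add_sum_filter_not B fun x => ((ones x).card : ℝ) ≤ L / 80]
  calc _ ≤ _ := abs_add_le _ _
    _ ≤ 1 / L * B.card + B.card * (2 * E) :=
        add_le_add hfew (hmany.trans (by gcongr))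
    _ = _ := by ring

end Decay

section LatticeBall

variable {q t : ℝ} {d : ℕ} {x : Fin d → ℤ}

theorem smul_mem_latticeBall (ε : Fin d → ℤˣ) (hx : x ∈ latticeBall q d t) :
    ε • x ∈ latticeBall q d t := by
  have habs : ∀ i, |((ε • x) i : ℝ)| = |(x i : ℝ)| := fun i => by
    rcases Int.units_eq_one_or (ε i) with h | h <;> simp [h]
  change ∑ i, |((ε • x) i : ℝ)| ^ q ≤ t ^ q
  simp only [habs]
  exact hx

theorem comp_perm_mem_latticeBall (σ : Equiv.Perm (Fin d)) (hx : x ∈ latticeBall q d t) :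
    x ∘ σ ∈ latticeBall q d t :=
  (Equiv.sum_comp σ fun i => |(x i : ℝ)| ^ q).trans_le hx

theorem sum_abs_le_of_mem_latticeBall (hq : 1 ≤ q) (hx : x ∈ latticeBall q d t) :
    ∑ i, |(x i : ℝ)| ≤ t ^ q := by
  refine (Finset.sum_le_sum fun i _ => ?_).trans hx
  rcases eq_or_ne (x i) 0 with h | h
  · simpa [h] using Real.rpow_nonneg le_rfl q
  · exact Real.self_le_rpow_of_one_le (by exact_mod_cast Int.one_le_abs h) hq

theorem indicator_mem_latticeBall (hq : q ≠ 0) {I : Finset (Fin d)} (hI : (I.card : ℝ) ≤ t ^ q) :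
    Set.indicator I 1 ∈ latticeBall q d t := by
  classical
  have hterm : ∀ i, |((Set.indicator I 1 i : ℤ) : ℝ)| ^ q = if i ∈ I then 1 else 0 := by
    intro i
    by_cases hi : i ∈ I <;> simp [hi, Real.zero_rpow hq]
  simpa [latticeBall, ball, hterm] using hI

theorem sub_single_add_single_mem_latticeBall (hq : 1 ≤ q) (hx : x ∈ latticeBall q d t)
    {i j : Fin d} (hj : 0 < x j) (hi : x i = 0) :
    x - Pi.single j 1 + Pi.single i 1 ∈ latticeBall q d t := by
  have hij : i ≠ j := by rintro rfl; omega
  set y := x - Pi.single j 1 + Pi.single i 1 with hy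
  have hyi : y i = 1 := by simp [hy, hi, hij]
  have hyj : y j = x j - 1 := by simp [hy, hij.symm]
  have hyl : ∀ l, l ≠ i ∧ l ≠ j → y l = x l := fun l hl => by simp [hy, hl.1, hl.2]
  have hxj : (1 : ℝ) ≤ x j := by exact_mod_cast hj
  have hrpow := Real.add_rpow_le_rpow_add (sub_nonneg.2 hxj) zero_le_one hq
  rw [sub_add_cancel, Real.one_rpow] at hrpow
  refine le_trans (?_ : ∑ l, |(y l : ℝ)| ^ q ≤ ∑ l, |(x l : ℝ)| ^ q) hx
  rw [← sub_nonpos, ← Finset.sum_sub_distrib,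
    Fintype.sum_eq_add i j hij fun l hl => by rw [hyl l hl, sub_self], hyi, hyj, hi]
  push_cast
  rw [abs_one, abs_zero, abs_of_nonneg (sub_nonneg.2 hxj), abs_of_nonneg (zero_le_one.trans hxj),
    Real.one_rpow, Real.zero_rpow (by linarith)]
  linarith

theorem average_eq {B : Finset (Fin d → ℤ)} (hB : (B : Set (Fin d → ℤ)) = latticeBall q d t)
    (f : (Fin d → ℤ) → ℂ) : average q d t f = (B.card : ℂ)⁻¹ * ∑ x ∈ B, f x := by
  rw [average, ← hB, Set.ncard_coe_finset, finsum_mem_coe_finset, one_div]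

theorem norm_inv_natCast_mul_le {n : ℕ} {z : ℂ} {b : ℝ} (hb : 0 ≤ b) (hz : ‖z‖ ≤ n * b) :
    ‖(n : ℂ)⁻¹ * z‖ ≤ b := by
  rw [norm_mul, norm_inv, Complex.norm_natCast]
  exact inv_mul_le_of_le_mul₀ (Nat.cast_nonneg n) hb hz

theorem average_one (ht : 0 ≤ t) (hq : 1 ≤ q) : average q d t (fun _ => 1) = 1 := by
  obtain ⟨B, hB⟩ := (latticeBall_finite hq d ht).exists_finset_coe
  have hzero : (0 : Fin d → ℤ) ∈ latticeBall q d t := by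
    simpa [latticeBall, ball, Real.zero_rpow (by linarith : q ≠ 0)] using Real.rpow_nonneg ht q
  rw [← hB, Finset.mem_coe] at hzero
  rw [average_eq hB, Finset.sum_const, nsmul_one,
    inv_mul_cancel₀ (Nat.cast_ne_zero.2 (Finset.card_ne_zero_of_mem hzero))]

end LatticeBall

section Torus

variable {d : ℕ}

theorem torusNorm_sq (ξ : Fin d → ℝ) : torusNorm ξ ^ 2 = ∑ i, Real.sin (Real.pi * ξ i) ^ 2 :=
  Real.sq_sqrt (Finset.sum_nonneg fun _ _ => sq_nonneg _)

theorem torusNorm_halfShift_sq (ξ : Fin d → ℝ) :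
    torusNorm (halfShift ξ) ^ 2 = ∑ i, (1 - Real.sin (Real.pi * ξ i) ^ 2) := by
  rw [torusNorm_sq]
  refine Finset.sum_congr rfl fun i _ => ?_
  rw [halfShift, mul_add, mul_one_div, Real.sin_add_pi_div_two, Real.cos_sq']

theorem neg_one_zpow_sum_smul {ι : Type*} [Fintype ι] (ε : ι → ℤˣ) (x : ι → ℤ) :
    (-1 : ℂ) ^ (∑ i, (ε • x) i) = (-1 : ℂ) ^ (∑ i, x i) := by
  have heven : Even (∑ i, (ε • x) i - ∑ i, x i) := by
    rw [← Finset.sum_sub_distrib]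
    refine Finset.even_sum _ fun i _ => ?_
    rcases Int.units_eq_one_or (ε i) with h | h <;> simp [h, Int.even_sub]
  rw [← sub_add_cancel (∑ i, (ε • x) i) (∑ i, x i), zpow_add₀ (by norm_num), heven.neg_one_zpow,
    one_mul]

theorem e_add_intCast_mul_half (s : ℝ) (m : ℤ) : e (s + m * (1 / 2)) = (-1 : ℂ) ^ m * e s := by
  rw [e, e, ← Complex.exp_pi_mul_I, ← Complex.exp_int_mul, ← Complex.exp_add]
  push_cast
  ring_nf

theorem neg_one_zpow_mul_e_halfShift (x : Fin d → ℤ) (ξ : Fin d → ℝ) :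
    (-1 : ℂ) ^ (∑ i, x i) * e (∑ i, (x i : ℝ) * halfShift ξ i) = e (∑ i, (x i : ℝ) * ξ i) := by
  have hshift : ∑ i, (x i : ℝ) * halfShift ξ i =
      ∑ i, (x i : ℝ) * ξ i + ((∑ i, x i : ℤ) : ℝ) * (1 / 2) := by
    simp only [halfShift, mul_add, Finset.sum_add_distrib, Int.cast_sum, Finset.sum_mul]
  rw [hshift, e_add_intCast_mul_half, ← mul_assoc, ← mul_zpow]
  norm_num

end Torus

section Multiplier

variable {q t : ℝ} {d : ℕ}

theorem norm_multiplier_le {c : ℝ} (hc : IsKrawtchoukConstant c) (hq : 1 ≤ q) (ht : 0 < t)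
    (htd : Real.exp 12 * t ^ q ≤ d) (ξ : Fin d → ℝ) :
    ‖multiplier q d t ξ‖ ≤ 64 * (Real.exp (-(c * (t ^ q / d) / 320 *
      min (torusNorm ξ ^ 2) (torusNorm (halfShift ξ) ^ 2))) + 1 / t ^ q) := by
  obtain ⟨B, hB⟩ := (latticeBall_finite hq d ht.le).exists_finset_coe
  have hmem : ∀ {x}, x ∈ B ↔ x ∈ latticeBall q d t := by simp [← hB]
  have hL : 0 < t ^ q := Real.rpow_pos_of_pos ht q
  have hsign : IsSignInvariant B := fun ε x hx => hmem.2 (smul_mem_latticeBall ε (hmem.1 hx))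
  have hsum := hsign.sum_mul_e (s := fun _ => 1) (fun _ _ => rfl) ξ
  simp only [one_mul, ← Complex.ofReal_sum] at hsum
  rw [multiplier, average_eq hB, hsum, torusNorm_halfShift_sq, torusNorm_sq]
  refine norm_inv_natCast_mul_le (by positivity) ?_
  rw [Complex.norm_real, Real.norm_eq_abs]
  set E := Real.exp _
  have hE : 0 < E := Real.exp_pos _
  rcases le_or_gt 64 (t ^ q) with h₆₄ | h₆₄
  · have hdecay := abs_sum_cosProd_le hc (fun σ x hx => hmem.2
      (comp_perm_mem_latticeBall σ (hmem.1 hx))) (fun x hx => sum_abs_le_of_mem_latticeBall hq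
      (hmem.1 hx)) (fun I hI => hmem.2 (indicator_mem_latticeBall (by linarith) hI)) h₆₄
      (by simpa using htd) ξ
    rw [Fintype.card_fin] at hdecay
    refine hdecay.trans ?_
    have : 0 < 1 / t ^ q := by positivity
    gcongr
    linarith
  · have htrivial : |∑ x ∈ B, cosProd ξ x| ≤ B.card * 1 := by
      rw [mul_one, ← nsmul_one]
      exact (Finset.abs_sum_le_sum_abs _ _).trans
        (Finset.sum_le_card_nsmul _ _ _ fun x _ => abs_cosProd_le_one ξ x)
    refine htrivial.trans ?_
    gcongr
    have : 1 / 64 ≤ 1 / t ^ q := one_div_le_one_div_of_le hL h₆₄.le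
    linarith

theorem norm_average_mul_e_sub_average_le (hq : 1 ≤ q) (ht : 0 ≤ t) (hd : 1 ≤ d)
    (htd : Real.exp 12 * t ^ q ≤ d) {s : (Fin d → ℤ) → ℂ}
    (hs : ∀ (ε : Fin d → ℤˣ) x, s (ε • x) = s x) (hs₁ : ∀ x, ‖s x‖ ≤ 1) (ξ : Fin d → ℝ) :
    ‖average q d t (fun x => s x * e (∑ i, (x i : ℝ) * ξ i)) - average q d t s‖ ≤
      64 * (t ^ q / d * torusNorm ξ ^ 2) := by
  obtain ⟨B, hB⟩ := (latticeBall_finite hq d ht).exists_finset_coe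
  have hmem : ∀ {x}, x ∈ B ↔ x ∈ latticeBall q d t := by simp [← hB]
  have hsign : IsSignInvariant B := fun ε x hx => hmem.2 (smul_mem_latticeBall ε (hmem.1 hx))
  have : Nonempty (Fin d) := ⟨⟨0, hd⟩⟩
  have htd₁₂ : 12 * t ^ q ≤ Fintype.card (Fin d) := by
    rw [Fintype.card_fin]
    nlinarith [Real.add_one_le_exp (12 : ℝ), Real.rpow_nonneg ht q]
  have hlow := norm_sum_mul_cosProd_sub_le hsign (fun x hx i j hj hi => hmem.2
    (sub_single_add_single_mem_latticeBall hq (hmem.1 hx) hj hi))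
    (fun x hx => sum_abs_le_of_mem_latticeBall hq (hmem.1 hx)) htd₁₂ hs₁ ξ
  rw [Fintype.card_fin] at hlow
  rw [average_eq hB, average_eq hB, ← mul_sub, hsign.sum_mul_e hs, torusNorm_sq]
  exact norm_inv_natCast_mul_le (by positivity) hlow

theorem norm_multiplier_sub_one_le (hq : 1 ≤ q) (ht : 0 ≤ t) (hd : 1 ≤ d)
    (htd : Real.exp 12 * t ^ q ≤ d) (ξ : Fin d → ℝ) :
    ‖multiplier q d t ξ - 1‖ ≤ 64 * (t ^ q / d * torusNorm ξ ^ 2) := by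
  have h := norm_average_mul_e_sub_average_le hq ht hd htd (s := fun _ => 1) (fun _ _ => rfl)
    (fun _ => norm_one.le) ξ
  simpa only [multiplier, one_mul, average_one ht hq] using h

theorem norm_multiplier_sub_signedAverage_le (hq : 1 ≤ q) (ht : 0 ≤ t) (hd : 1 ≤ d)
    (htd : Real.exp 12 * t ^ q ≤ d) (ξ : Fin d → ℝ) :
    ‖multiplier q d t ξ - signedAverage q d t‖ ≤
      64 * (t ^ q / d * torusNorm (halfShift ξ) ^ 2) := by
  have h := norm_average_mul_e_sub_average_le hq ht hd htd
    (s := fun x => (-1 : ℂ) ^ (∑ i, x i)) neg_one_zpow_sum_smul (fun x => by simp) (halfShift ξ)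
  simpa only [multiplier, signedAverage, neg_one_zpow_mul_e_halfShift] using h

theorem div_rpow_one_div_rpow (hq : q ≠ 0) (ht : 0 ≤ t) (d : ℕ) :
    (t / (d : ℝ) ^ (1 / q)) ^ q = t ^ q / d := by
  rw [Real.div_rpow ht (by positivity), ← Real.rpow_mul (Nat.cast_nonneg _),
    one_div_mul_cancel hq, Real.rpow_one]

end Multiplier

end LqBall

open LqBall in
theorem proposition3p5_general :
    (∃ c : ℝ, IsKrawtchoukConstant c) ∧
    ∃ C : ℝ, 0 < C ∧
      ∀ (q : ℝ) (d : ℕ) (t : ℝ), 1 ≤ q → 1 ≤ d → 0 < t →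
        t / (d : ℝ) ^ (1 / q) ≤ Real.exp (-12 / q) →
        ∀ ξ : Fin d → ℝ,
          (∀ c : ℝ, IsKrawtchoukConstant c →
            ‖multiplier q d t ξ‖ ≤
              C * (Real.exp (-(c * (t / (d : ℝ) ^ (1 / q)) ^ q / 320 *
                    min (torusNorm ξ ^ 2) (torusNorm (halfShift ξ) ^ 2)))
                  + 1 / t ^ q)) ∧
          ‖multiplier q d t ξ - 1‖ ≤ C * ((t / (d : ℝ) ^ (1 / q)) ^ q * torusNorm ξ ^ 2) ∧
          ‖multiplier q d t ξ - signedAverage q d t‖ ≤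
            C * ((t / (d : ℝ) ^ (1 / q)) ^ q * torusNorm (halfShift ξ) ^ 2) := by
  refine ⟨⟨_, isKrawtchoukConstant_one_div_sixteen⟩, 64, by norm_num, ?_⟩
  intro q d t hq hd ht hκ ξ
  have hq₀ : q ≠ 0 := by linarith
  have hκq := div_rpow_one_div_rpow hq₀ ht.le d
  have htd : Real.exp 12 * t ^ q ≤ d := by
    have h := Real.rpow_le_rpow (by positivity) hκ (by linarith : 0 ≤ q)
    rwa [hκq, ← Real.exp_mul, div_mul_cancel₀ _ hq₀, div_le_iff₀ (by exact_mod_cast hd),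
      Real.exp_neg, ← div_eq_inv_mul, le_div_iff₀' (Real.exp_pos _)] at h
  rw [hκq]
  exact ⟨fun c hc => norm_multiplier_le hc hq ht htd ξ,
    norm_multiplier_sub_one_le hq ht.le hd htd ξ,
    norm_multiplier_sub_signedAverage_le hq ht.le hd htd ξ⟩

theorem proposition3p5 :
    (∃ c : ℝ, LqBall.IsKrawtchoukConstant c) ∧
    ∃ C : ℝ, 0 < C ∧
      ∀ (q : ℝ) (d N : ℕ), 1 ≤ q → 1 ≤ d → 1 ≤ N →
        LqBall.kappa q d N ≤ Real.exp (-12 / q) →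
        ∀ ξ : Fin d → ℝ,
          (∀ c : ℝ, LqBall.IsKrawtchoukConstant c →
            ‖LqBall.multiplier q d N ξ‖ ≤
              C * (Real.exp (-(c * LqBall.kappa q d N ^ q / 320 *
                    min (LqBall.torusNorm ξ ^ 2)
                      (LqBall.torusNorm (LqBall.halfShift ξ) ^ 2)))
                  + 1 / (N : ℝ) ^ q)) ∧
          (LqBall.torusNorm ξ ≤ LqBall.torusNorm (LqBall.halfShift ξ) →
            ‖LqBall.multiplier q d N ξ - 1‖ ≤
              C * (LqBall.kappa q d N ^ q * LqBall.torusNorm ξ ^ 2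
                  + 1 / (N : ℝ) ^ q
                  + LqBall.kappa q d N ^ (q / 50))) ∧
          (LqBall.torusNorm (LqBall.halfShift ξ) < LqBall.torusNorm ξ →
            ‖LqBall.multiplier q d N ξ - LqBall.signedAverage q d N‖ ≤
              C * (LqBall.kappa q d N ^ q * LqBall.torusNorm (LqBall.halfShift ξ) ^ 2
                  + 1 / (N : ℝ) ^ q
                  + LqBall.kappa q d N ^ (q / 50))) := by
  obtain ⟨hexists, C, hC, h⟩ := proposition3p5_general
  refine ⟨hexists, C, hC, fun q d N hq hd hN hκ ξ => ?_⟩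
  obtain ⟨hdecay, hone, hsigned⟩ := h q d N hq hd (by exact_mod_cast hN) hκ ξ
  have herror : 0 ≤ 1 / (N : ℝ) ^ q + LqBall.kappa q d N ^ (q / 50) := by
    rw [LqBall.kappa]; positivity
  refine ⟨hdecay, fun _ => hone.trans ?_, fun _ => hsigned.trans ?_⟩ <;>
    exact mul_le_mul_of_nonneg_left (by rw [add_assoc]; exact le_add_of_nonneg_right herror) hC.le
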